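/- An instance of the stable marriage problem with two-sided ties and two-sided critical vertices consists of a finite bipartite graph $G=(A\cup B,E)$, for each vertex a ranking of its neighbours by natural numbers (a smaller rank is better, equal ranks are ties), and a set $C\subseteq A\cup B$ of critical vertices. A matching is a set $M\subseteq E$ of edges no two of which share an end-point; $M(u)$ denotes the partner of a matched vertex $u$. A matching $M$ is critical if no matching of $G$ matches more critical vertices than $M$. A pair $(a,b)\in E\setminus M$ blocks $M$ if $a$ is unmatched or strictly prefers $b$ to $M(a)$, and $b$ is unmatched or strictly prefers $a$ to $M(b)$. A matching $M$ is relaxed stable if for every pair $(a,b)$ that blocks $M$, either $a$ is matched and $M(a)$ is critical, or $b$ is matched and $M(b)$ is critical. Theorem. Every such instance $G$ has a matching $M$ that is critical and relaxed stable and satisfies $|M|\ge \frac23|M'|$ for every critical relaxed stable matching $M'$ of $G$ (in particular for one of maximum size). Moreover, such a matching can be computed in time $O(n\cdot|E|)$, where $n=|A\cup B|$: there are one fixed program for a unit-cost random access machine (with addition, truncated subtraction, arrays with indirect addressing, and memory that is initially zero outside the input) and a constant $c$ such that, on every instance, given by the preference lists of all vertices with their ranks (each list sorted by rank, ties in any order)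 and the flags of the critical vertices, the program halts after at most $c\,(n\cdot|E|+1)$ steps and outputs a matching $M$ as above. -/

import Mathlib

/-! ## The stable marriage problem with ties and critical vertices -/

namespace CritMatch

/-- A stable marriage instance with two-sided ties and two-sided critical vertices: a bipartite
graph with sides `A` and `B` and edge set `edges`.  `rankA a b` is the rank of the edge `(a, b)`
in the preference list of `a`, and `rankB b a` its rank in the preference list of `b`; smaller is
better, equal ranks are ties, and only the ranks on edges matter. -/
structure MarriageInstance (A B : Type*) where
  edges : Finset (A × B)
  rankA : A → B → ℕ
  rankB : B → A → ℕ
  critA : Finset A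
  critB : Finset B

section Matchings

variable {A B : Type*} (I : MarriageInstance A B)

/-- A set of edges no two of which share an end-point. -/
def IsMatching (M : Finset (A × B)) : Prop :=
  M ⊆ I.edges ∧
    (∀ a b b', (a, b) ∈ M → (a, b') ∈ M → b = b') ∧
    (∀ a a' b, (a, b) ∈ M → (a', b) ∈ M → a = a')

open Classical in
/-- The number of critical vertices, on both sides, that `M` matches. -/
noncomputable def numCritical (M : Finset (A × B)) : ℕ :=
  (I.critA.filter (fun a => ∃ b, (a, b) ∈ M)).card +
    (I.critB.filter (fun b => ∃ a, (a, b) ∈ M)).card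

/-- No matching matches more critical vertices than the matching `M`. -/
def IsCritical (M : Finset (A × B)) : Prop :=
  IsMatching I M ∧ ∀ N, IsMatching I N → numCritical I N ≤ numCritical I M

/-- `(a, b)` blocks `M`: it is an edge outside `M`, each end-point of which is unmatched or
strictly prefers the other end-point to its partner in `M`. -/
def Blocks (M : Finset (A × B)) (a : A) (b : B) : Prop :=
  (a, b) ∈ I.edges ∧ (a, b) ∉ M ∧
    ((∀ b', (a, b') ∉ M) ∨ ∃ b', (a, b') ∈ M ∧ I.rankA a b < I.rankA a b') ∧
    ((∀ a', (a', b) ∉ M) ∨ ∃ a', (a', b) ∈ M ∧ I.rankB b a < I.rankB b a')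

/-- `M` is a matching each blocking pair `(a, b)` of which is justified: `a` is matched to a
critical vertex, or `b` is matched to a critical vertex. -/
def IsRelaxedStable (M : Finset (A × B)) : Prop :=
  IsMatching I M ∧ ∀ a b, Blocks I M a b →
    (∃ b', (a, b') ∈ M ∧ b' ∈ I.critB) ∨ (∃ a', (a', b) ∈ M ∧ a' ∈ I.critA)

/-- Critical relaxed stable matchings. -/
def IsCriticalRSM (M : Finset (A × B)) : Prop :=
  IsCritical I M ∧ IsRelaxedStable I M

end Matchings

/-! ## A random access machine with a step count

Memory consists of number registers and of arrays of numbers with indirect addressing; a program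
uses finitely many registers and arrays.  The only arithmetic is addition and (truncated)
subtraction.  Every memory access, arithmetic operation, assignment and branch costs one step. -/

structure RState where
  reg : ℕ → ℕ
  arr : ℕ → ℕ → ℕ

inductive RExp where
  | lit (k : ℕ) : RExp
  | reg (x : ℕ) : RExp
  | get (r : ℕ) (i : RExp) : RExp
  | add (e f : RExp) : RExp
  | sub (e f : RExp) : RExp

def RExp.eval (s : RState) : RExp → ℕ
  | .lit k => k
  | .reg x => s.reg x
  | .get r i => s.arr r (i.eval s)
  | .add e f => e.eval s + f.eval s
  | .sub e f => e.eval s - f.eval s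

/-- The number of steps needed to evaluate an expression. -/
def RExp.cost : RExp → ℕ
  | .lit _ => 1
  | .reg _ => 1
  | .get _ i => i.cost + 1
  | .add e f => e.cost + f.cost + 1
  | .sub e f => e.cost + f.cost + 1

inductive RProg where
  | skip : RProg
  | set (x : ℕ) (e : RExp) : RProg
  | put (r : ℕ) (i e : RExp) : RProg
  | seq (p q : RProg) : RProg
  | ite (e : RExp) (p q : RProg) : RProg
  | loop (e : RExp) (p : RProg) : RProg

def RState.setReg (s : RState) (x v : ℕ) : RState :=
  { s with reg := Function.update s.reg x v }

def RState.setArr (s : RState) (r i v : ℕ) : RState :=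
  { s with arr := Function.update s.arr r (Function.update (s.arr r) i v) }

/-- `Exec p s k s'`: started in the state `s`, the program `p` halts after exactly `k` steps, in
the state `s'`.  A test succeeds if its value is not `0`; `loop e p` repeats `p` while the test
`e` succeeds. -/
inductive Exec : RProg → RState → ℕ → RState → Prop where
  | skip (s : RState) : Exec .skip s 1 s
  | set (s : RState) (x : ℕ) (e : RExp) :
      Exec (.set x e) s (e.cost + 1) (s.setReg x (e.eval s))
  | put (s : RState) (r : ℕ) (i e : RExp) :
      Exec (.put r i e) s (i.cost + e.cost + 1) (s.setArr r (i.eval s) (e.eval s))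
  | seq {p q : RProg} {s s' s'' : RState} {k l : ℕ} :
      Exec p s k s' → Exec q s' l s'' → Exec (.seq p q) s (k + l) s''
  | ite_true {e : RExp} {p q : RProg} {s s' : RState} {k : ℕ} :
      e.eval s ≠ 0 → Exec p s k s' → Exec (.ite e p q) s (e.cost + 1 + k) s'
  | ite_false {e : RExp} {p q : RProg} {s s' : RState} {k : ℕ} :
      e.eval s = 0 → Exec q s k s' → Exec (.ite e p q) s (e.cost + 1 + k) s'
  | loop_true {e : RExp} {p : RProg} {s s' s'' : RState} {k l : ℕ} :
      e.eval s ≠ 0 → Exec p s k s' → Exec (.loop e p) s' l s'' →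
        Exec (.loop e p) s (e.cost + 1 + k + l) s''
  | loop_false {e : RExp} {p : RProg} {s : RState} :
      e.eval s = 0 → Exec (.loop e p) s (e.cost + 1) s

/-! ## Input and output of the machine -/

section Encoding

variable {A B : Type*} [Fintype A] [Fintype B]

/-- A presentation of an instance: the vertices of each side are numbered from `0`, and each
vertex has a list of its neighbours in order of preference (ties in any order). -/
structure Presentation (I : MarriageInstance A B) where
  idxA : A ≃ Fin (Fintype.card A)
  idxB : B ≃ Fin (Fintype.card B)
  prefA : A → List B
  prefB : B → List A
  nodup_prefA : ∀ a, (prefA a).Nodup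
  nodup_prefB : ∀ b, (prefB b).Nodup
  mem_prefA : ∀ a b, b ∈ prefA a ↔ (a, b) ∈ I.edges
  mem_prefB : ∀ b a, a ∈ prefB b ↔ (a, b) ∈ I.edges
  sorted_prefA : ∀ a, (prefA a).Pairwise (fun b b' => I.rankA a b ≤ I.rankA a b')
  sorted_prefB : ∀ b, (prefB b).Pairwise (fun a a' => I.rankB b a ≤ I.rankB b a')

/-- One side `U` of an instance is stored in the arrays `r, ..., r + 3` of `s`.  The preference
lists of the vertices are stored one after the other: the list of `u` starts at the position
`s.arr r (idx u)`, array `r + 1` holds the numbers of the neighbours and array `r + 2` their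
ranks.  Array `r + 3` holds the flags of the critical vertices. -/
def StoresSide {U V : Type*} [Fintype U] [Fintype V]
    (idx : U ≃ Fin (Fintype.card U)) (idx' : V ≃ Fin (Fintype.card V))
    (pref : U → List V) (rank : U → V → ℕ) (crit : Finset U) (s : RState) (r : ℕ) : Prop :=
  s.arr r 0 = 0 ∧
    (∀ u, s.arr r ((idx u : ℕ) + 1) = s.arr r (idx u : ℕ) + (pref u).length) ∧
    (∀ u k v, (pref u)[k]? = some v →
      s.arr (r + 1) (s.arr r (idx u : ℕ) + k) = (idx' v : ℕ) ∧
      s.arr (r + 2) (s.arr r (idx u : ℕ) + k) = rank u v) ∧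
    (∀ u, (u ∈ crit → s.arr (r + 3) (idx u : ℕ) = 1) ∧
      (u ∉ crit → s.arr (r + 3) (idx u : ℕ) = 0))

/-- An initial state for a presented instance: registers `0` and `1` hold the numbers of vertices
of the two sides, arrays `0, ..., 3` store the side `A`, arrays `4, ..., 7` the side `B`, and all
other registers and arrays are `0`. -/
def IsInput {I : MarriageInstance A B} (P : Presentation I) (s : RState) : Prop :=
  s.reg 0 = Fintype.card A ∧ s.reg 1 = Fintype.card B ∧ (∀ x, 2 ≤ x → s.reg x = 0) ∧
    StoresSide P.idxA P.idxB P.prefA I.rankA I.critA s 0 ∧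
    StoresSide P.idxB P.idxA P.prefB I.rankB I.critB s 4 ∧
    (∀ r i, 8 ≤ r → s.arr r i = 0)

/-- Array `8` of `s` stores the matching `M`: its entry for a vertex `a` is `0` if `a` is
unmatched, and `j + 1` if `a` is matched to the vertex with the number `j`. -/
def IsOutput {I : MarriageInstance A B} (P : Presentation I) (s : RState)
    (M : Finset (A × B)) : Prop :=
  (∀ a b, (a, b) ∈ M → s.arr 8 (P.idxA a : ℕ) = (P.idxB b : ℕ) + 1) ∧
    (∀ a, (∀ b, (a, b) ∉ M) → s.arr 8 (P.idxA a : ℕ) = 0)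

end Encoding

end CritMatch

set_option linter.unusedSectionVars false
namespace CritMatch

/-! ## Offers -/

/-! The matching comes from deferred acceptance in which every `a` works through a list of offers
and every `b` keeps the best offer received, comparing classes before keys. With `|A|` and `|B|` the
sizes of the sides, the list has three stages. In the classes `0, ..., |B| - 1`, `a` asks only its
critical neighbours. Then it descends its preference list, and at each tie it makes all provisional
offers (class `|B|`) before the firm ones (class `|B| + 1`). Finally come plain offers to all
neighbours: one round in class `|B| + 1`, winning ties against firm offers, and, if `a` is critical,
`|A|` further rounds in increasing classes. `Outcome` records what survives of the process; all the
combinatorics rests on it.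

Critical (`Outcome.isCritical`): if a vertex of one side is unmatched, then by pigeonhole some class
reserved for that side occurs in no accepted offer. Any competing matching joins the critical
vertices beyond this gap only to partners of critical vertices beyond the gap, so it covers no more
of them; the other critical vertices are all matched (`card_covered_le`).

Relaxed stable (`Outcome.isRelaxedStable`): unless its partner is critical, `a` has made firm offers
to all neighbours it strictly prefers to its partner, and each of these holds an offer from a
critical vertex or from one ranked no worse than `a`.

Size (`Outcome.two_mul_card_le`): compared with a relaxed stable matching there is no augmenting
path with one or three edges (`not_both_unmatched`, `no_short_path`), which gives the factor `2/3`.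

Time: the lists of offers have total length `O(n |E|)`, each proposal takes boundedly many steps,
and every proposal but one per vertex of `A` causes a rejection. The program writes the lists
explicitly and then moves pointers through them. Existence of the matching is read off from a run.
-/

/-- An offer to the vertex `dest`, who prefers offers of a larger class, and among those of the same
class the ones with a smaller key. -/
structure Offer (B : Type*) where
  dest : B
  cls : ℕ
  key : ℕ

def Offer.Beats {B : Type*} (o o' : Offer B) : Prop :=
  o'.cls < o.cls ∨ o.cls = o'.cls ∧ o.key < o'.key

section Offers

variable {A B : Type*} [Fintype A] [Fintype B] (I : MarriageInstance A B)

/-- Doubling the rank leaves the odd keys to firm offers, which thus lose exactly the ties against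
plain offers of their class. -/
def plainOffer (a : A) (b : B) (r : ℕ) : Offer B := ⟨b, r, 2 * I.rankB b a⟩

/-- The offers by which `a` asks `b` for a stable partnership; they lose ties against the plain
offers of the same class. -/
def firmOffer (a : A) (b : B) : Offer B := ⟨b, Fintype.card B + 1, 2 * I.rankB b a + 1⟩

/-- `l` contains the offers of `a` to its critical neighbours in the classes below `r`. -/
def LowDone (a : A) (l : List (Offer B)) (r : ℕ) : Prop :=
  ∀ r' < r, ∀ b ∈ I.critB, (a, b) ∈ I.edges → plainOffer I a b r' ∈ l

/-- `l` contains the firm offers of `a`, and the first `r` rounds of plain offers after them. -/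
def HighDone (a : A) (l : List (Offer B)) (r : ℕ) : Prop :=
  (∀ b, (a, b) ∈ I.edges → firmOffer I a b ∈ l) ∧
    ∀ r' < r, ∀ b, (a, b) ∈ I.edges → plainOffer I a b (Fintype.card B + 1 + r') ∈ l

/-- `Valid I a l o`: the vertex `a` may make the offer `o` after the offers in `l`. -/
inductive Valid (a : A) (l : List (Offer B)) : Offer B → Prop where
  | low (r : ℕ) (b : B) : r < Fintype.card B → b ∈ I.critB → (a, b) ∈ I.edges →
      LowDone I a l r → Valid a l (plainOffer I a b r)
  | provisional (b : B) : (a, b) ∈ I.edges → LowDone I a l (Fintype.card B) →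
      (∀ b', (a, b') ∈ I.edges → I.rankA a b' < I.rankA a b → firmOffer I a b' ∈ l) →
      Valid a l (plainOffer I a b (Fintype.card B))
  | firm (b : B) : (a, b) ∈ I.edges → LowDone I a l (Fintype.card B) →
      (∀ b', (a, b') ∈ I.edges → I.rankA a b' < I.rankA a b → firmOffer I a b' ∈ l) →
      (∀ b', (a, b') ∈ I.edges → I.rankA a b' ≤ I.rankA a b →
        plainOffer I a b' (Fintype.card B) ∈ l) →
      Valid a l (firmOffer I a b)
  | high (r : ℕ) (b : B) : (a, b) ∈ I.edges → LowDone I a l (Fintype.card B) →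
      HighDone I a l r → (r ≠ 0 → a ∈ I.critA) →
      Valid a l (plainOffer I a b (Fintype.card B + 1 + r))

/-- Every offer in `l` is valid after the ones before it. -/
def ValidList (a : A) (l : List (Offer B)) : Prop :=
  ∀ j o, l[j]? = some o → Valid I a (l.take j) o

/-- The `|A|` rounds after the first give `|A|` classes used by critical vertices alone, as many as
the pigeonhole argument needs. -/
def CompleteList (a : A) (l : List (Offer B)) : Prop :=
  LowDone I a l (Fintype.card B) ∧ HighDone I a l 1 ∧
    (a ∈ I.critA → HighDone I a l (Fintype.card A + 1))

/-- The result of deferred acceptance: `cur a` is the accepted offer of `a`, and `made a` are its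
rejected offers. -/
structure Outcome (cur : A → Option (Offer B)) (made : A → List (Offer B)) : Prop where
  valid : ∀ a o, cur a = some o → Valid I a (made a) o
  complete : ∀ a, cur a = none → CompleteList I a (made a)
  rejected : ∀ a, ∀ o ∈ made a, ∃ c o', cur c = some o' ∧ o'.dest = o.dest ∧ ¬ o.Beats o'
  inj : ∀ a c o o', cur a = some o → cur c = some o' → o.dest = o'.dest → a = c

open Classical in
noncomputable def acceptedPairs (cur : A → Option (Offer B)) : Finset (A × B) :=
  Finset.univ.filter (fun e => ∃ o, cur e.1 = some o ∧ o.dest = e.2)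

theorem mem_acceptedPairs {cur : A → Option (Offer B)} {a : A} {b : B} :
    (a, b) ∈ acceptedPairs cur ↔ ∃ o, cur a = some o ∧ o.dest = b := by
  simp [acceptedPairs]

theorem unmatched_iff {cur : A → Option (Offer B)} {a : A} :
    (∀ b, (a, b) ∉ acceptedPairs cur) ↔ cur a = none := by
  simp only [mem_acceptedPairs]
  constructor
  · intro h
    cases ho : cur a with
    | none => rfl
    | some o => exact absurd ⟨o, ho, rfl⟩ (h o.dest)
  · rintro h b ⟨o, ho, -⟩
    simp [h] at ho

variable {I}

theorem Valid.edge {a : A} {l : List (Offer B)} {o : Offer B} (h : Valid I a l o) :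
    (a, o.dest) ∈ I.edges := by
  cases h <;> assumption

theorem LowDone.mono {a : A} {l l' : List (Offer B)} {r r' : ℕ} (h : LowDone I a l r)
    (hr : r' ≤ r) (hl : l ⊆ l') : LowDone I a l' r' :=
  fun i hi b hb he => hl (h i (by omega) b hb he)

theorem HighDone.mono {a : A} {l l' : List (Offer B)} {r r' : ℕ} (h : HighDone I a l r)
    (hr : r' ≤ r) (hl : l ⊆ l') : HighDone I a l' r' :=
  ⟨fun b he => hl (h.1 b he), fun i hi b he => hl (h.2 i (by omega) b he)⟩

theorem Valid.mono {a : A} {l l' : List (Offer B)} {o : Offer B} (h : Valid I a l o)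
    (hl : l ⊆ l') : Valid I a l' o := by
  cases h with
  | low r b h1 h2 h3 h4 => exact .low r b h1 h2 h3 (h4.mono le_rfl hl)
  | provisional b h1 h2 h3 =>
    exact .provisional b h1 (h2.mono le_rfl hl) fun b' h h' => hl (h3 b' h h')
  | firm b h1 h2 h3 h4 =>
    exact .firm b h1 (h2.mono le_rfl hl) (fun b' h h' => hl (h3 b' h h'))
      fun b' h h' => hl (h4 b' h h')
  | high r b h1 h2 h3 h4 => exact .high r b h1 (h2.mono le_rfl hl) (h3.mono le_rfl hl) h4

theorem ValidList.append {a : A} {l : List (Offer B)} {o : Offer B} (h : ValidList I a l)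
    (ho : Valid I a l o) : ValidList I a (l ++ [o]) := by
  intro j o' hj
  rcases lt_trichotomy j l.length with hlt | rfl | hgt
  · rw [List.getElem?_append_left hlt] at hj
    rw [List.take_append_of_le_length hlt.le]
    exact h j o' hj
  · simp at hj
    subst hj
    simpa using ho
  · rw [List.getElem?_eq_none (by simp; omega)] at hj
    cases hj

open Classical in
/-- A relation version of the exchange argument: if `M` covers everything in `X` outside `D`, and
everything that `N` joins to `X ∩ D` is covered by `M` from `X ∩ D`, then `M` covers at least as
much of `X` as `N`. -/
theorem card_covered_le {V W : Type*} (X : Finset V) (D : V → Prop) (M N : V → W → Prop)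
    (hM : ∀ v w w', M v w → M v w' → w = w') (hN : ∀ v v' w, N v w → N v' w → v = v')
    (hD : ∀ v ∈ X, D v → ∀ w, N v w → ∃ v' ∈ X, D v' ∧ M v' w)
    (hX : ∀ v ∈ X, ¬ D v → ∃ w, M v w) :
    (X.filter fun v => ∃ w, N v w).card ≤ (X.filter fun v => ∃ w, M v w).card := by
  -- A vertex of `D` goes to the `M`-partner of its `N`-partner, any other vertex to itself; the two
  -- kinds of images lie inside and outside `D`.
  apply Finset.card_le_card_of_forall_subsingleton
    (fun v v' => (D v ∧ D v' ∧ ∃ w, N v w ∧ M v' w) ∨ (¬ D v ∧ v' = v))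
  · intro v hv
    obtain ⟨hv, w, hw⟩ := Finset.mem_filter.1 hv
    by_cases h : D v
    · obtain ⟨v', hv', hd, hm⟩ := hD v hv h w hw
      exact ⟨v', Finset.mem_filter.2 ⟨hv', w, hm⟩, .inl ⟨h, hd, w, hw, hm⟩⟩
    · exact ⟨v, Finset.mem_filter.2 ⟨hv, hX v hv h⟩, .inr ⟨h, rfl⟩⟩
  · rintro v' - v₁ ⟨-, h₁⟩ v₂ ⟨-, h₂⟩
    rcases h₁ with ⟨-, hd, w₁, hn₁, hm₁⟩ | ⟨hd₁, rfl⟩ <;>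
      rcases h₂ with ⟨-, hd', w₂, hn₂, hm₂⟩ | ⟨hd₂, e⟩
    · obtain rfl := hM _ _ _ hm₁ hm₂
      exact hN _ _ _ hn₁ hn₂
    · exact absurd hd (e ▸ hd₂)
    · exact absurd hd' hd₁
    · exact e

/-! ### Outcomes are critical, relaxed stable and large -/

namespace Outcome

variable {cur : A → Option (Offer B)} {made : A → List (Offer B)} (h : Outcome I cur made)
include h

theorem isMatching : IsMatching I (acceptedPairs cur) := by
  refine ⟨?_, ?_, ?_⟩
  · rintro ⟨a, b⟩ hab
    obtain ⟨o, ho, rfl⟩ := mem_acceptedPairs.1 hab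
    exact (h.valid a o ho).edge
  · intro a b b' h₁ h₂
    obtain ⟨o, ho, rfl⟩ := mem_acceptedPairs.1 h₁
    obtain ⟨o', ho', rfl⟩ := mem_acceptedPairs.1 h₂
    rw [ho] at ho'
    cases ho'
    rfl
  · intro a a' b h₁ h₂
    obtain ⟨o, ho, rfl⟩ := mem_acceptedPairs.1 h₁
    obtain ⟨o', ho', e⟩ := mem_acceptedPairs.1 h₂
    exact h.inj _ _ _ _ ho ho' e.symm

theorem exists_class_of_made {a : A} {o : Offer B} (ho : o ∈ made a) :
    ∃ c o', cur c = some o' ∧ o'.dest = o.dest ∧ o.cls ≤ o'.cls ∧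
      (o'.cls = o.cls → o'.key ≤ o.key) := by
  obtain ⟨c, o', h1, h2, h3⟩ := h.rejected a o ho
  refine ⟨c, o', h1, h2, ?_⟩
  simp only [Offer.Beats] at h3
  grind

theorem lowDone_of_cls {a : A} (i : ℕ) (hi : i < Fintype.card B)
    (ha : ∀ o, cur a = some o → i < o.cls) : LowDone I a (made a) (i + 1) := by
  cases hc : cur a with
  | none => exact (h.complete a hc).1.mono hi (List.Subset.refl _)
  | some o =>
    have := ha o hc
    cases h.valid a o hc with
    | low r b h1 h2 h3 h4 => exact h4.mono this (List.Subset.refl _)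
    | provisional b h1 h2 h3 => exact h2.mono hi (List.Subset.refl _)
    | firm b h1 h2 h3 h4 => exact h2.mono hi (List.Subset.refl _)
    | high r b h1 h2 h3 h4 => exact h2.mono hi (List.Subset.refl _)

/-- If all `|B|` low classes occurred, their offers would have distinct destinations, which would
exhaust `B` and include `b₀`. -/
theorem exists_low_gap {b₀ : B} (hb : ∀ a, (a, b₀) ∉ acceptedPairs cur) :
    ∃ i < Fintype.card B, ∀ a o, cur a = some o → o.cls ≠ i := by
  by_contra! hall
  choose f g hf hg using fun i : Fin (Fintype.card B) => hall i i.2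
  have hinj : Function.Injective fun i => (g i).dest := by
    intro i j hij
    have e := h.inj _ _ _ _ (hf i) (hf j) hij
    have e' := hf i
    rw [e, hf j] at e'
    apply Fin.ext
    rw [← hg i, ← hg j, Option.some.inj e']
  obtain ⟨i, hi⟩ := ((Fintype.bijective_iff_injective_and_card _).2 ⟨hinj, by simp⟩).2 b₀
  exact hb _ (mem_acceptedPairs.2 ⟨_, hf i, hi⟩)

/-- Likewise with senders: one vertex has only one accepted offer, so `|A|` occurring classes would
use up all of `A`. -/
theorem exists_high_gap {a₀ : A} (ha : cur a₀ = none) :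
    ∃ i < Fintype.card A, ∀ a o, cur a = some o → o.cls ≠ Fintype.card B + 1 + (i + 1) := by
  by_contra! hall
  choose f g hf hg using fun i : Fin (Fintype.card A) => hall i i.2
  have hinj : Function.Injective f := by
    intro i j hij
    have e' := hf i
    rw [hij, hf j] at e'
    have := hg i
    rw [← Option.some.inj e', hg j] at this
    exact Fin.ext (by omega)
  obtain ⟨i, rfl⟩ := ((Fintype.bijective_iff_injective_and_card _).2 ⟨hinj, by simp⟩).2 a₀
  simp [hf i] at ha

/-- The two sides are treated separately, each by the exchange argument at an empty class if a
critical vertex of that side is unmatched. -/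
theorem isCritical : IsCritical I (acceptedPairs cur) := by
  refine ⟨h.isMatching, fun N hN => ?_⟩
  obtain ⟨-, hm1, hm2⟩ := h.isMatching
  obtain ⟨hN0, hN1, hN2⟩ := hN
  unfold numCritical
  apply Nat.add_le_add
  · by_cases hall : ∀ a ∈ I.critA, cur a ≠ none
    · apply card_covered_le I.critA (fun _ => False) (fun a b => (a, b) ∈ acceptedPairs cur)
        (fun a b => (a, b) ∈ N) hm1 (fun a a' b => hN2 a a' b) (by simp)
      intro a ha _
      by_contra! hh
      exact hall a ha (unmatched_iff.1 hh)
    push Not at hall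
    obtain ⟨a₀, -, ha₀⟩ := hall
    obtain ⟨i, hi, hgap⟩ := h.exists_high_gap ha₀
    -- Beyond the gap are the unmatched critical vertices and those accepted in a higher class. Each
    -- was rejected in the class of the gap by all its neighbours, which therefore hold offers of
    -- still higher classes, and only critical vertices make those.
    apply card_covered_le I.critA
      (fun a => ∀ o, cur a = some o → Fintype.card B + 1 + (i + 1) < o.cls)
      (fun a b => (a, b) ∈ acceptedPairs cur)
      (fun a b => (a, b) ∈ N) hm1 (fun a a' b => hN2 a a' b) ?_ ?_
    swap
    · intro a _ hd
      push Not at hd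
      obtain ⟨o, ho, -⟩ := hd
      exact ⟨o.dest, mem_acceptedPairs.2 ⟨o, ho, rfl⟩⟩
    · intro a ha hd b hab
      have he := hN0 hab
      have hmade : plainOffer I a b (Fintype.card B + 1 + (i + 1)) ∈ made a := by
        cases hc : cur a with
        | none => exact ((h.complete a hc).2.2 ha).2 _ (by omega) b he
        | some o =>
          have hlt := hd o hc
          cases h.valid a o hc with
          | high r b' h1 h2 h3 h4 =>
            simp only [plainOffer] at hlt
            exact h3.2 _ (by omega) b he
          | _ => simp [plainOffer, firmOffer] at hlt; omega
      obtain ⟨c, o, hc, hto, hcls, -⟩ := h.exists_class_of_made hmade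
      have hne := hgap c o hc
      simp only [plainOffer] at hto hcls
      refine ⟨c, ?_, ?_, mem_acceptedPairs.2 ⟨o, hc, hto⟩⟩
      · cases h.valid c o hc with
        | high r b' h1 h2 h3 h4 =>
          simp only [plainOffer] at hcls
          exact h4 (by omega)
        | _ => simp [plainOffer, firmOffer] at hcls <;> omega
      · intro o' ho'
        rw [hc] at ho'
        cases ho'
        omega
  · by_cases hall : ∀ b ∈ I.critB, ∃ a, (a, b) ∈ acceptedPairs cur
    · exact card_covered_le I.critB (fun _ => False) (fun b a => (a, b) ∈ acceptedPairs cur)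
        (fun b a => (a, b) ∈ N) (fun b a a' => hm2 a a' b) (fun b b' a => hN1 a b b') (by simp)
        fun b hb _ => hall b hb
    push Not at hall
    obtain ⟨b₀, -, hb₀⟩ := hall
    obtain ⟨i, hi, hgap⟩ := h.exists_low_gap hb₀
    -- Here the vertices beyond the gap are the unmatched ones and those holding offers of class
    -- below `i`.
    apply card_covered_le I.critB
      (fun b => ∀ a o, cur a = some o → o.dest = b → o.cls < i)
      (fun b a => (a, b) ∈ acceptedPairs cur)
      (fun b a => (a, b) ∈ N) (fun b a a' => hm2 a a' b) (fun b b' a => hN1 a b b') ?_ ?_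
    swap
    · intro b _ hd
      push Not at hd
      obtain ⟨a, o, ho, hb, -⟩ := hd
      exact ⟨a, mem_acceptedPairs.2 ⟨o, ho, hb⟩⟩
    · intro b hb hd a hab
      have he := hN0 hab
      -- Otherwise `a` is unmatched or has passed class `i`, so it was rejected by `b` in class `i`,
      -- and `b` holds an offer of at least that class.
      have hsome : ∃ o, cur a = some o ∧ o.cls < i := by
        by_contra! hh
        have := h.lowDone_of_cls (a := a) i hi fun o ho =>
          lt_of_le_of_ne (hh o ho) (hgap a o ho).symm
        obtain ⟨c, o, hc, hto, hcls, -⟩ := h.exists_class_of_made (this i (by omega) b hb he)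
        have := hd c o hc hto
        simp only [plainOffer] at hcls
        omega
      obtain ⟨o, ho, hlt⟩ := hsome
      refine ⟨o.dest, ?_, ?_, mem_acceptedPairs.2 ⟨o, ho, rfl⟩⟩
      · cases h.valid a o ho with
        | low r b' h1 h2 h3 h4 => exact h2
        | _ => simp [plainOffer, firmOffer] at hlt; omega
      · intro c o' hc hto
        obtain rfl := h.inj _ _ _ _ hc ho hto
        rw [hc] at ho
        cases ho
        exact hlt

/-- A firm offer in the list of made offers is answered by a firm partner at least as good, or by
a critical one. -/
theorem exists_of_firm {a : A} {b : B} (ha : firmOffer I a b ∈ made a) :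
    ∃ c, (c, b) ∈ acceptedPairs cur ∧ (c ∈ I.critA ∨ I.rankB b c ≤ I.rankB b a) := by
  obtain ⟨c, o, hc, hto, hcls, hkey⟩ := h.exists_class_of_made ha
  refine ⟨c, mem_acceptedPairs.2 ⟨o, hc, hto⟩, ?_⟩
  cases h.valid c o hc with
  | low r b' h1 h2 h3 h4 => simp [plainOffer, firmOffer] at hcls; omega
  | provisional b' h1 h2 h3 => simp [plainOffer, firmOffer] at hcls
  | firm b' h1 h2 h3 h4 =>
    simp only [firmOffer] at hto hkey
    subst hto
    exact .inr (by have := hkey trivial; omega)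
  | high r b' h1 h2 h3 h4 =>
    simp only [firmOffer, plainOffer] at hto hkey
    subst hto
    by_cases hr : r = 0
    · exact .inr (by have := hkey (by omega); omega)
    · exact .inl (h4 hr)

/-- A blocking `a` whose partner is not critical has already been refused a firm partnership by `b`.
If the holder of `b` is not critical, then `b` ranks it no worse than `a`, so `b` has no reason to
block. -/
theorem isRelaxedStable : IsRelaxedStable I (acceptedPairs cur) := by
  refine ⟨h.isMatching, ?_⟩
  rintro a b ⟨he, -, ha, hb⟩
  have key : firmOffer I a b ∈ made a ∨ ∃ b', (a, b') ∈ acceptedPairs cur ∧ b' ∈ I.critB := by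
    rcases ha with ha | ⟨b', hb', hlt⟩
    · exact .inl ((h.complete a (unmatched_iff.1 ha)).2.1.1 b he)
    · obtain ⟨o, ho, rfl⟩ := mem_acceptedPairs.1 hb'
      cases h.valid a o ho with
      | low r b' h1 h2 h3 h4 => exact .inr ⟨b', hb', h2⟩
      | provisional b' h1 h2 h3 => exact .inl (h3 b he hlt)
      | firm b' h1 h2 h3 h4 => exact .inl (h3 b he hlt)
      | high r b' h1 h2 h3 h4 => exact .inl (h3.1 b he)
  refine key.elim (fun hf => ?_) .inl
  obtain ⟨c, hc, hcrit | hle⟩ := h.exists_of_firm hf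
  · exact .inr ⟨c, hc, hcrit⟩
  · rcases hb with hb | ⟨a', ha', hlt⟩
    · exact absurd hc (hb c)
    · obtain rfl := h.isMatching.2.2 _ _ _ hc ha'
      omega

theorem not_both_unmatched {a : A} {b : B} (he : (a, b) ∈ I.edges)
    (ha : ∀ b', (a, b') ∉ acceptedPairs cur) (hb : ∀ a', (a', b) ∉ acceptedPairs cur) : False := by
  obtain ⟨c, hc, -⟩ := h.exists_of_firm ((h.complete a (unmatched_iff.1 ha)).2.1.1 b he)
  exact hb c hc

/-- There is no augmenting path of length three. -/
theorem no_short_path {M : Finset (A × B)} (hM : IsRelaxedStable I M) {a₁ a₂ : A} {b₁ b₂ : B}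
    (h1 : (a₁, b₁) ∈ M) (h2 : (a₂, b₂) ∈ M) (h21 : (a₂, b₁) ∈ acceptedPairs cur)
    (ha : ∀ b, (a₁, b) ∉ acceptedPairs cur) (hb : ∀ a, (a, b₂) ∉ acceptedPairs cur) : False := by
  have e1 := hM.1.1 h1
  have e2 := hM.1.1 h2
  have hcomp := h.complete a₁ (unmatched_iff.1 ha)
  -- A vertex that has ever received an offer ends up matched.
  have hnot : ∀ o ∈ made a₂, o.dest ≠ b₂ := by
    rintro o ho rfl
    obtain ⟨c, o', hc, hto, -⟩ := h.exists_class_of_made ho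
    exact hb c (mem_acceptedPairs.2 ⟨o', hc, hto⟩)
  -- The offer of `a₂` held by `b₁` withstood every plain offer that the unmatched `a₁` made to
  -- `b₁`.
  have hmade : ∀ r, HighDone I a₁ (made a₁) (r + 1) → ∀ o, cur a₂ = some o → o.dest = b₁ →
      Fintype.card B + 1 + r ≤ o.cls ∧
        (o.cls = Fintype.card B + 1 + r → o.key ≤ 2 * I.rankB b₁ a₁) := by
    intro r hr o ho hto
    obtain ⟨c, o', hc, hto', hcls, hkey⟩ := h.exists_class_of_made (hr.2 r (by omega) b₁ e1)
    obtain rfl := h.inj _ _ _ _ hc ho (hto'.trans hto.symm)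
    rw [hc] at ho
    cases ho
    exact ⟨hcls, hkey⟩
  obtain ⟨o, ho, hto⟩ := mem_acceptedPairs.1 h21
  obtain ⟨hcls, hkey⟩ := hmade 0 hcomp.2.1 o ho hto
  have hcrit : a₁ ∈ I.critA → Fintype.card B + 1 + 1 ≤ o.cls := fun hcr =>
    (hmade 1 ((hcomp.2.2 hcr).mono
      (Nat.succ_le_succ (Fintype.card_pos_iff.2 ⟨a₁⟩)) (List.Subset.refl _)) o ho hto).1
  -- The class leaves only firm and high offers, and a high one would come after a firm offer to
  -- `b₂`.
  cases h.valid a₂ o ho with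
  | low r b' v1 v2 v3 v4 => simp [plainOffer] at hcls; omega
  | provisional b' v1 v2 v3 => simp [plainOffer] at hcls
  | high r b' v1 v2 v3 v4 => exact hnot _ (v3.1 b₂ e2) rfl
  | firm b' v1 v2 v3 v4 =>
    simp only [firmOffer] at hto hkey hcrit
    subst hto
    -- Parity: an odd firm key that is at most an even plain key is strictly below it.
    have hr1 : I.rankB b' a₂ < I.rankB b' a₁ := by have := hkey trivial; omega
    -- A firm offer comes after the provisional offers to all neighbours ranked no worse, and `b₂`
    -- received none.
    have hr2 : I.rankA a₂ b' < I.rankA a₂ b₂ := by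
      by_contra hle
      exact hnot _ (v4 b₂ e2 (not_lt.1 hle)) rfl
    have hblock : Blocks I M a₂ b' := by
      refine ⟨v1, fun hmem => ?_, .inr ⟨b₂, h2, hr2⟩, .inr ⟨a₁, h1, hr1⟩⟩
      obtain rfl := hM.1.2.2 _ _ _ hmem h1
      exact ha _ h21
    -- Neither justification is possible: a critical `b₂` would have been asked in class `0`, and a
    -- critical `a₁` would have asked in class `|B| + 2`, beating the firm offer.
    rcases hM.2 _ _ hblock with ⟨b, hb1, hb2⟩ | ⟨a, ha1, ha2⟩
    · obtain rfl := hM.1.2.1 _ _ _ hb1 h2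
      exact hnot _ (v2 0 (Fintype.card_pos_iff.2 ⟨b⟩) b hb2 e2) rfl
    · obtain rfl := hM.1.2.2 _ _ _ ha1 h1
      have := hcrit ha2
      omega

/-- `UA` and `UB` are the edges of `M` with an end in `A`, respectively in `B`, missed by `N`.
Distinct edges of `UA ∪ UB` touch distinct edges of `N`, so `|UA| + |UB| ≤ |N|`; moreover `|M| -
|UA| ≤ |N|` and `|M| - |UB| ≤ |N|`. The sum of the three is the claim. -/
theorem two_mul_card_le {M : Finset (A × B)} (hM : IsRelaxedStable I M) :
    2 * M.card ≤ 3 * (acceptedPairs cur).card := by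
  classical
  set N := acceptedPairs cur with hN
  obtain ⟨-, hn1, hn2⟩ := h.isMatching
  obtain ⟨hm0, hm1, hm2⟩ := hM.1
  set UA := M.filter fun e => ∀ b, (e.1, b) ∉ N with hUA
  set UB := M.filter fun e => ∀ a, (a, e.2) ∉ N with hUB
  have hdisj : Disjoint UA UB := by
    rw [Finset.disjoint_left]
    rintro ⟨a, b⟩ h1 h2
    rw [hUA, Finset.mem_filter] at h1
    rw [hUB, Finset.mem_filter] at h2
    exact h.not_both_unmatched (hm0 h1.1) h1.2 h2.2
  have c1 : (UA ∪ UB).card ≤ N.card := by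
    apply Finset.card_le_card_of_forall_subsingleton
      (fun e e' => e'.2 = e.2 ∧ e ∈ UA ∨ e'.1 = e.1 ∧ e ∈ UB)
    · rintro ⟨a, b⟩ he
      rcases Finset.mem_union.1 he with he' | he'
      · obtain ⟨hm, hu⟩ := Finset.mem_filter.1 he'
        by_contra! hh
        refine h.not_both_unmatched (hm0 hm) hu fun a' ha' => (hh (a', b) ha').1 rfl he'
      · obtain ⟨hm, hu⟩ := Finset.mem_filter.1 he'
        by_contra! hh
        refine h.not_both_unmatched (hm0 hm) (fun b' hb' => (hh (a, b') hb').2 rfl he') hu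
    · have cross : ∀ e₁ ∈ UA, ∀ e₂ ∈ UB, ∀ e ∈ N, e.2 = e₁.2 → e.1 = e₂.1 → False := by
        rintro ⟨a₁, b₁⟩ h1 ⟨a₂, b₂⟩ h2 ⟨a, b⟩ he hb ha
        obtain ⟨hm1, hu1⟩ := Finset.mem_filter.1 h1
        obtain ⟨hm2, hu2⟩ := Finset.mem_filter.1 h2
        simp only at hb ha
        subst hb ha
        exact h.no_short_path hM hm1 hm2 he hu1 hu2
      rintro e he e₁ ⟨-, h₁⟩ e₂ ⟨-, h₂⟩
      rcases h₁ with ⟨q₁, m₁⟩ | ⟨q₁, m₁⟩ <;> rcases h₂ with ⟨q₂, m₂⟩ | ⟨q₂, m₂⟩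
      · have k₁ := (Finset.mem_filter.1 m₁).1
        have k₂ := (Finset.mem_filter.1 m₂).1
        rcases e₁ with ⟨x₁, y₁⟩; rcases e₂ with ⟨x₂, y₂⟩
        simp only at q₁ q₂
        subst q₁ q₂
        rw [hm2 _ _ _ k₁ k₂]
      · exact (cross _ m₁ _ m₂ e he q₁ q₂).elim
      · exact (cross _ m₂ _ m₁ e he q₂ q₁).elim
      · have k₁ := (Finset.mem_filter.1 m₁).1
        have k₂ := (Finset.mem_filter.1 m₂).1
        rcases e₁ with ⟨x₁, y₁⟩; rcases e₂ with ⟨x₂, y₂⟩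
        simp only at q₁ q₂
        subst q₁ q₂
        rw [hm1 _ _ _ k₁ k₂]
  have c2 : (M \ UA).card ≤ N.card := by
    apply Finset.card_le_card_of_forall_subsingleton (fun e e' => e'.1 = e.1)
    · rintro ⟨a, b⟩ he
      simp only [hUA, Finset.mem_sdiff, Finset.mem_filter, not_and, not_forall, not_not] at he
      obtain ⟨b', hb'⟩ := he.2 he.1
      exact ⟨(a, b'), hb', rfl⟩
    · rintro e he ⟨x₁, y₁⟩ ⟨m₁, q₁⟩ ⟨x₂, y₂⟩ ⟨m₂, q₂⟩
      have k₁ := (Finset.mem_sdiff.1 m₁).1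
      have k₂ := (Finset.mem_sdiff.1 m₂).1
      simp only at q₁ q₂
      subst q₁ q₂
      rw [hm1 _ _ _ k₁ k₂]
  have c3 : (M \ UB).card ≤ N.card := by
    apply Finset.card_le_card_of_forall_subsingleton (fun e e' => e'.2 = e.2)
    · rintro ⟨a, b⟩ he
      simp only [hUB, Finset.mem_sdiff, Finset.mem_filter, not_and, not_forall, not_not] at he
      obtain ⟨a', ha'⟩ := he.2 he.1
      exact ⟨(a', b), ha', rfl⟩
    · rintro e he ⟨x₁, y₁⟩ ⟨m₁, q₁⟩ ⟨x₂, y₂⟩ ⟨m₂, q₂⟩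
      have k₁ := (Finset.mem_sdiff.1 m₁).1
      have k₂ := (Finset.mem_sdiff.1 m₂).1
      simp only at q₁ q₂
      subst q₁ q₂
      rw [hm2 _ _ _ k₁ k₂]
  have sA : UA ⊆ M := Finset.filter_subset _ _
  have sB : UB ⊆ M := Finset.filter_subset _ _
  rw [Finset.card_union_of_disjoint hdisj] at c1
  rw [Finset.card_sdiff_of_subset sA] at c2
  rw [Finset.card_sdiff_of_subset sB] at c3
  omega

theorem isCriticalRSM : IsCriticalRSM I (acceptedPairs cur) :=
  ⟨h.isCritical, h.isRelaxedStable⟩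

theorem two_thirds_le {M : Finset (A × B)} (hM : IsCriticalRSM I M) :
    (2 / 3 : ℚ) * (M.card : ℚ) ≤ ((acceptedPairs cur).card : ℚ) := by
  have := h.two_mul_card_le hM.2
  have : (2 * M.card : ℚ) ≤ 3 * (acceptedPairs cur).card := by exact_mod_cast this
  linarith

end Outcome

/-! ## Deferred acceptance -/

/-- The state of deferred acceptance after `a` has been rejected `k a` times: the vertices in `D`
take part, `free` is the one whose next offer is due, and `h b` is the vertex whose offer `b`
holds. -/
structure DeferredAcceptance (l : A → List (Offer B)) (D : Set A) (free : Option A) (k : A → ℕ)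
    (h : B → Option A) : Prop where
  held : ∀ b a, h b = some a → a ∈ D ∧ free ≠ some a ∧ ∃ o, (l a)[k a]? = some o ∧ o.dest = b
  settled : ∀ a ∈ D, free ≠ some a → ∀ o, (l a)[k a]? = some o → h o.dest = some a
  rejected : ∀ a j o, j < k a → (l a)[j]? = some o →
    ∃ c o', h o.dest = some c ∧ (l c)[k c]? = some o' ∧ ¬ o.Beats o'
  waiting : ∀ a, a ∉ D → k a = 0

/-- This keeps an old rejection justified when the rejecting vertex trades up. -/
theorem Offer.Beats.not_of_not {o o' x : Offer B} (h : o.Beats o') (hx : ¬ x.Beats o') :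
    ¬ x.Beats o := by
  simp only [Offer.Beats] at *
  omega

theorem Offer.Beats.asymm {o o' : Offer B} (h : o.Beats o') : ¬ o'.Beats o := by
  simp only [Offer.Beats] at *
  omega

namespace DeferredAcceptance

variable {l : A → List (Offer B)} {D : Set A} {k : A → ℕ} {h : B → Option A} {a c : A}
  {o o' : Offer B}

theorem init (l : A → List (Offer B)) :
    DeferredAcceptance l ∅ none (fun _ => 0) (fun _ => none) := by
  constructor <;> simp

theorem activate (H : DeferredAcceptance l D none k h) (ha : a ∉ D) :
    DeferredAcceptance l (insert a D) (some a) k h where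
  held b c hc := by
    obtain ⟨h1, -, h3⟩ := H.held b c hc
    exact ⟨.inr h1, fun e => ha (Option.some.inj e ▸ h1), h3⟩
  settled c hc hne o ho := by
    refine H.settled c (hc.resolve_left fun e => hne (e ▸ rfl)) (by simp) o ho
  rejected := H.rejected
  waiting c hc := H.waiting c fun h => hc (.inr h)

theorem finish (H : DeferredAcceptance l D (some a) k h) (ha : (l a)[k a]? = none) :
    DeferredAcceptance l D none k h where
  held b c hc := by
    obtain ⟨h1, -, h3⟩ := H.held b c hc
    exact ⟨h1, by simp, h3⟩
  settled c hc _ o ho := by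
    refine H.settled c hc ?_ o ho
    rintro e
    cases e
    simp [ha] at ho
  rejected := H.rejected
  waiting := H.waiting

open Classical in
theorem accept (H : DeferredAcceptance l D (some a) k h) (haD : a ∈ D)
    (ha : (l a)[k a]? = some o) (hb : h o.dest = none) :
    DeferredAcceptance l D none k (Function.update h o.dest (some a)) where
  held b c hc := by
    by_cases e : b = o.dest
    · subst e
      rw [Function.update_self] at hc
      cases hc
      exact ⟨haD, by simp, o, ha, rfl⟩
    · rw [Function.update_of_ne e] at hc
      obtain ⟨h1, -, h3⟩ := H.held b c hc
      exact ⟨h1, by simp, h3⟩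
  settled c hc _ x hx := by
    by_cases e : c = a
    · subst e
      rw [ha] at hx
      cases hx
      simp
    · have := H.settled c hc (fun e' => e (Option.some.inj e').symm) x hx
      rwa [Function.update_of_ne]
      rintro e'
      rw [e', hb] at this
      cases this
  rejected c j x hj hx := by
    obtain ⟨d, y, h1, h2, h3⟩ := H.rejected c j x hj hx
    refine ⟨d, y, ?_, h2, h3⟩
    rwa [Function.update_of_ne]
    rintro e'
    rw [e', hb] at h1
    cases h1
  waiting := H.waiting

open Classical in
theorem replace (H : DeferredAcceptance l D (some a) k h) (haD : a ∈ D)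
    (ha : (l a)[k a]? = some o) (hb : h o.dest = some c) (hc : (l c)[k c]? = some o')
    (hbeats : o.Beats o') :
    DeferredAcceptance l D (some c) (Function.update k c (k c + 1))
      (Function.update h o.dest (some a)) where
  held b d hd := by
    obtain ⟨hcD, hca, x, hx, hxo⟩ := H.held _ _ hb
    have hac : a ≠ c := fun e => hca (e ▸ rfl)
    by_cases e : b = o.dest
    · subst e
      rw [Function.update_self] at hd
      cases hd
      exact ⟨haD, fun e => hac (Option.some.inj e).symm, o, by rwa [Function.update_of_ne hac], rfl⟩
    · rw [Function.update_of_ne e] at hd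
      obtain ⟨h1, -, y, hy, hyo⟩ := H.held b d hd
      have hdc : d ≠ c := by
        rintro rfl
        rw [hx] at hy
        cases hy
        exact e (hyo.symm.trans hxo)
      exact ⟨h1, fun e => hdc (Option.some.inj e).symm, y, by rwa [Function.update_of_ne hdc], hyo⟩
  settled d hd hne x hx := by
    have hdc : d ≠ c := fun e => hne (e ▸ rfl)
    rw [Function.update_of_ne hdc] at hx
    by_cases e : d = a
    · subst e
      rw [ha] at hx
      cases hx
      simp
    · have := H.settled d hd (fun e' => e (Option.some.inj e').symm) x hx
      rwa [Function.update_of_ne]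
      rintro e'
      rw [e', hb] at this
      exact hdc (Option.some.inj this).symm
  rejected d j x hj hx := by
    obtain ⟨hcD, hca, y, hy, hyo⟩ := H.held _ _ hb
    rw [hc] at hy
    cases hy
    have hac : a ≠ c := fun e => hca (e ▸ rfl)
    have old : j < k d ∨ d = c ∧ x = o' := by
      by_cases e : d = c
      · subst e
        rw [Function.update_self] at hj
        rcases (Nat.lt_succ_iff_lt_or_eq.1 hj) with hj | rfl
        · exact .inl hj
        · rw [hc] at hx
          exact .inr ⟨rfl, (Option.some.inj hx).symm⟩
      · rw [Function.update_of_ne e] at hj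
        exact .inl hj
    rcases old with hj | ⟨rfl, rfl⟩
    · obtain ⟨f, z, h1, h2, h3⟩ := H.rejected d j x hj hx
      -- At `o.dest` the rejection is now justified by the better `o`. Elsewhere the holder is
      -- unchanged and is not `c`, who was held only at `o.dest`.
      by_cases e : x.dest = o.dest
      · rw [e, hb] at h1
        cases h1
        rw [hc] at h2
        cases h2
        exact ⟨a, o, by rw [e, Function.update_self], by rwa [Function.update_of_ne hac],
          hbeats.not_of_not h3⟩
      · have hfc : f ≠ c := by
          rintro rfl
          obtain ⟨-, -, w, hw, hwo⟩ := H.held _ _ h1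
          rw [hc] at hw
          cases hw
          exact e (hwo.symm.trans hyo)
        exact ⟨f, z, by rwa [Function.update_of_ne e], by rwa [Function.update_of_ne hfc], h3⟩
    · exact ⟨a, o, by rw [hyo, Function.update_self], by rwa [Function.update_of_ne hac],
        hbeats.asymm⟩
  waiting d hd := by
    have : d ≠ c := by
      rintro rfl
      exact hd (H.held _ _ hb).1
    rw [Function.update_of_ne this]
    exact H.waiting d hd

open Classical in
theorem reject (H : DeferredAcceptance l D (some a) k h) (haD : a ∈ D)
    (ha : (l a)[k a]? = some o) (hb : h o.dest = some c) (hc : (l c)[k c]? = some o')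
    (hbeats : ¬ o.Beats o') :
    DeferredAcceptance l D (some a) (Function.update k a (k a + 1)) h where
  held b d hd := by
    obtain ⟨h1, h2, h3⟩ := H.held b d hd
    have hda : d ≠ a := fun e => h2 (e ▸ rfl)
    rw [Function.update_of_ne hda]
    exact ⟨h1, h2, h3⟩
  settled d hd hne x hx := by
    have hda : d ≠ a := fun e => hne (e ▸ rfl)
    rw [Function.update_of_ne hda] at hx
    exact H.settled d hd hne x hx
  rejected d j x hj hx := by
    have key : ∃ f z, h x.dest = some f ∧ (l f)[k f]? = some z ∧ ¬ x.Beats z := by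
      by_cases e : d = a
      · subst e
        rw [Function.update_self] at hj
        rcases (Nat.lt_succ_iff_lt_or_eq.1 hj) with hj | rfl
        · exact H.rejected d j x hj hx
        · rw [ha] at hx
          cases hx
          exact ⟨c, o', hb, hc, hbeats⟩
      · rw [Function.update_of_ne e] at hj
        exact H.rejected d j x hj hx
    obtain ⟨f, z, h1, h2, h3⟩ := key
    have hfa : f ≠ a := fun e => (H.held _ _ h1).2.1 (e ▸ rfl)
    exact ⟨f, z, h1, by rwa [Function.update_of_ne hfa], h3⟩
  waiting d hd := by
    have hda : d ≠ a := by
      rintro rfl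
      exact hd haD
    rw [Function.update_of_ne hda]
    exact H.waiting d hd

theorem outcome (H : DeferredAcceptance l Set.univ none k h) (hv : ∀ a, ValidList I a (l a))
    (hcomp : ∀ a, CompleteList I a (l a)) :
    Outcome I (fun a => (l a)[k a]?) (fun a => (l a).take (k a)) where
  valid a o ho := hv a _ o ho
  complete a ha := by
    rw [List.take_of_length_le (by simpa using ha)]
    exact hcomp a
  rejected a o ho := by
    obtain ⟨j, hj⟩ := List.mem_iff_getElem?.1 ho
    have hjk : j < k a := by
      by_contra hn
      simp [hn] at hj
    rw [List.getElem?_take, if_pos hjk] at hj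
    obtain ⟨c, o', h1, h2, h3⟩ := H.rejected a j o hjk hj
    obtain ⟨-, -, x, hx, hxo⟩ := H.held _ _ h1
    rw [h2] at hx
    cases hx
    exact ⟨c, o', h2, hxo, h3⟩
  inj a c o o' ho ho' e := by
    have h1 := H.settled a trivial (by simp) o ho
    have h2 := H.settled c trivial (by simp) o' ho'
    rw [e, h2] at h1
    exact (Option.some.inj h1).symm

end DeferredAcceptance

-- The number of offers not yet rejected is the potential that pays for the proposals.
open Classical in
theorem sum_length_sub_update {l : A → List (Offer B)} {k : A → ℕ} {c : A} {o : Offer B}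
    (hc : (l c)[k c]? = some o) :
    (∑ a, ((l a).length - Function.update k c (k c + 1) a)) + 1 = ∑ a, ((l a).length - k a) := by
  have hlt : k c < (l c).length := (List.getElem?_eq_some_iff.1 hc).1
  rw [← Finset.add_sum_erase _ _ (Finset.mem_univ c),
    ← Finset.add_sum_erase _ (fun a => (l a).length - k a) (Finset.mem_univ c)]
  have : ∀ a ∈ Finset.univ.erase c,
      (l a).length - Function.update k c (k c + 1) a = (l a).length - k a := by
    intro a ha
    rw [Function.update_of_ne (Finset.ne_of_mem_erase ha)]
  rw [Finset.sum_congr rfl this, Function.update_self]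
  omega

end Offers

/-! ## Reasoning about programs -/

/-- Started in `s`, the program `p` halts after `k` steps in a state `s'` with `Q k s'`. -/
def Spec (p : RProg) (s : RState) (Q : ℕ → RState → Prop) : Prop :=
  ∃ k s', Exec p s k s' ∧ Q k s'

theorem Spec.mono {p : RProg} {s : RState} {Q Q' : ℕ → RState → Prop} (h : Spec p s Q)
    (hQ : ∀ k s', Q k s' → Q' k s') : Spec p s Q' :=
  let ⟨k, s', he, hq⟩ := h
  ⟨k, s', he, hQ _ _ hq⟩

theorem spec_skip {s : RState} {Q : ℕ → RState → Prop} (h : Q 1 s) : Spec .skip s Q :=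
  ⟨_, _, .skip s, h⟩

theorem spec_set {x : ℕ} {e : RExp} {s : RState} {Q : ℕ → RState → Prop}
    (h : Q (e.cost + 1) (s.setReg x (e.eval s))) : Spec (.set x e) s Q :=
  ⟨_, _, .set s x e, h⟩

theorem spec_put {r : ℕ} {i e : RExp} {s : RState} {Q : ℕ → RState → Prop}
    (h : Q (i.cost + e.cost + 1) (s.setArr r (i.eval s) (e.eval s))) : Spec (.put r i e) s Q :=
  ⟨_, _, .put s r i e, h⟩

theorem spec_seq {p q : RProg} {s : RState} {Q : ℕ → RState → Prop}
    (h : Spec p s fun k s' => Spec q s' fun l s'' => Q (k + l) s'') : Spec (.seq p q) s Q :=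
  let ⟨_, _, hp, _, _, hq, h⟩ := h
  ⟨_, _, .seq hp hq, h⟩

theorem spec_ite {e : RExp} {p q : RProg} {s : RState} {Q : ℕ → RState → Prop}
    (hp : e.eval s ≠ 0 → Spec p s fun k => Q (e.cost + 1 + k))
    (hq : e.eval s = 0 → Spec q s fun k => Q (e.cost + 1 + k)) : Spec (.ite e p q) s Q := by
  by_cases h : e.eval s = 0
  · obtain ⟨k, s', hk, hQ⟩ := hq h
    exact ⟨_, _, .ite_false h hk, hQ⟩
  · obtain ⟨k, s', hk, hQ⟩ := hp h
    exact ⟨_, _, .ite_true h hk, hQ⟩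

/-- The first argument of the invariant bounds the number of steps still to be spent. -/
theorem spec_loop {e : RExp} {p : RProg} {Q : ℕ → RState → Prop} (Inv : ℕ → RState → Prop)
    (step : ∀ n s, Inv n s → e.eval s ≠ 0 →
      Spec p s fun k s' => ∃ m, Inv m s' ∧ m + k + e.cost + 1 ≤ n)
    {n : ℕ} {s : RState} (h : Inv n s)
    (done : ∀ m k s', Inv m s' → e.eval s' = 0 → k + m ≤ n + e.cost + 1 → Q k s') :
    Spec (.loop e p) s Q := by
  induction n using Nat.strong_induction_on generalizing s Q with
  | _ n ih =>
    by_cases he : e.eval s = 0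
    · exact ⟨_, _, .loop_false he, done n _ s h he (by omega)⟩
    · obtain ⟨k, s', hk, m, hm, hle⟩ := step n s h he
      obtain ⟨l, s'', hl, hQ⟩ := ih m (by omega) hm (Q := fun l => Q (e.cost + 1 + k + l))
        fun m' k' s'' h1 h2 h3 => done m' _ s'' h1 h2 (by omega)
      exact ⟨_, _, .loop_true he hk hl, hQ⟩

/-! ### Memory updates and frame conditions -/

@[simp] theorem reg_setReg (s : RState) (x v y : ℕ) :
    (s.setReg x v).reg y = if y = x then v else s.reg y := by
  simp [RState.setReg, Function.update_apply]

@[simp] theorem arr_setReg (s : RState) (x v : ℕ) : (s.setReg x v).arr = s.arr := rfl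

@[simp] theorem reg_setArr (s : RState) (r i v : ℕ) : (s.setArr r i v).reg = s.reg := rfl

@[simp] theorem arr_setArr (s : RState) (r i v r' i' : ℕ) :
    (s.setArr r i v).arr r' i' = if r' = r ∧ i' = i then v else s.arr r' i' := by
  by_cases h : r' = r
  · subst h
    simp [RState.setArr, Function.update_apply]
  · simp [RState.setArr, h]

/-- `s'` agrees with `s`, except for the arrays in `R` and the registers in `X`. -/
structure Agree (R X : Finset ℕ) (s s' : RState) : Prop where
  reg : ∀ x, x ∉ X → s'.reg x = s.reg x
  arr : ∀ r, r ∉ R → s'.arr r = s.arr r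

namespace Agree

variable {R R' X X' : Finset ℕ} {s s' s'' : RState}

theorem refl (R X : Finset ℕ) (s : RState) : Agree R X s s := ⟨fun _ _ => rfl, fun _ _ => rfl⟩

theorem setReg (h : Agree R X s s') {x : ℕ} (hx : x ∈ X) (v : ℕ) : Agree R X s (s'.setReg x v) where
  reg y hy := by
    have : y ≠ x := fun e => hy (e ▸ hx)
    simp [this, h.reg y hy]
  arr r hr := by simp [h.arr r hr]

theorem setArr (h : Agree R X s s') {r : ℕ} (hr : r ∈ R) (i v : ℕ) :
    Agree R X s (s'.setArr r i v) where
  reg y hy := by simp [h.reg y hy]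
  arr q hq := by
    have : q ≠ r := fun e => hq (e ▸ hr)
    funext j
    simp [this, h.arr q hq]

theorem trans (h : Agree R X s s') (h' : Agree R X s' s'') : Agree R X s s'' where
  reg y hy := by rw [h'.reg y hy, h.reg y hy]
  arr r hr := by rw [h'.arr r hr, h.arr r hr]

theorem mono (h : Agree R X s s') (hR : R ⊆ R') (hX : X ⊆ X') : Agree R' X' s s' where
  reg y hy := h.reg y fun e => hy (hX e)
  arr r hr := h.arr r fun e => hr (hR e)

end Agree

/-! ### The stored input and its offsets -/

section Input

variable {A B : Type*} [Fintype A] [Fintype B] {I : MarriageInstance A B} (P : Presentation I)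

/-- The part of `IsInput` that remains true while the program works. -/
structure Stored (s : RState) : Prop where
  cardA : s.reg 0 = Fintype.card A
  cardB : s.reg 1 = Fintype.card B
  sideA : StoresSide P.idxA P.idxB P.prefA I.rankA I.critA s 0
  sideB : StoresSide P.idxB P.idxA P.prefB I.rankB I.critB s 4

variable {P}

theorem Stored.agree {s s' : RState} {R X : Finset ℕ} (h : Stored P s) (ha : Agree R X s s')
    (hR : ∀ r < 8, r ∉ R) (h0 : 0 ∉ X) (h1 : 1 ∉ X) : Stored P s' where
  cardA := by rw [ha.reg 0 h0, h.cardA]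
  cardB := by rw [ha.reg 1 h1, h.cardB]
  sideA := by
    have := h.sideA
    simp only [StoresSide] at this ⊢
    rw [ha.arr _ (hR 0 (by omega)), ha.arr _ (hR (0 + 1) (by omega)),
      ha.arr _ (hR (0 + 2) (by omega)), ha.arr _ (hR (0 + 3) (by omega))]
    exact this
  sideB := by
    have := h.sideB
    simp only [StoresSide] at this ⊢
    rw [ha.arr _ (hR 4 (by omega)), ha.arr _ (hR (4 + 1) (by omega)),
      ha.arr _ (hR (4 + 2) (by omega)), ha.arr _ (hR (4 + 3) (by omega))]
    exact this

theorem IsInput.stored {s : RState} (h : IsInput P s) : Stored P s :=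
  ⟨h.1, h.2.1, h.2.2.2.1, h.2.2.2.2.1⟩

theorem exists_idxA {i : ℕ} (hi : i < Fintype.card A) : ∃ a, (P.idxA a : ℕ) = i :=
  ⟨P.idxA.symm ⟨i, hi⟩, by simp⟩

theorem idxA_inj {a c : A} : (P.idxA a : ℕ) = P.idxA c ↔ a = c := by
  rw [Fin.val_inj, P.idxA.apply_eq_iff_eq]

theorem idxB_inj {b c : B} : (P.idxB b : ℕ) = P.idxB c ↔ b = c := by
  rw [Fin.val_inj, P.idxB.apply_eq_iff_eq]

theorem StoresSide.mono {U V : Type*} [Fintype U] [Fintype V]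
    {idx : U ≃ Fin (Fintype.card U)} {idx' : V ≃ Fin (Fintype.card V)}
    {pref : U → List V} {rank : U → V → ℕ} {crit : Finset U} {s : RState} {r : ℕ}
    (h : StoresSide idx idx' pref rank crit s r) {i j : ℕ} (hij : i ≤ j)
    (hj : j ≤ Fintype.card U) : s.arr r i ≤ s.arr r j := by
  induction j, hij using Nat.le_induction with
  | base => exact le_rfl
  | succ j hij ih =>
    have := h.2.1 (idx.symm ⟨j, hj⟩)
    simp only [Equiv.apply_symm_apply] at this
    have := ih (by omega)
    omega

theorem StoresSide.sum {U V : Type*} [Fintype U] [Fintype V]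
    {idx : U ≃ Fin (Fintype.card U)} {idx' : V ≃ Fin (Fintype.card V)}
    {pref : U → List V} {rank : U → V → ℕ} {crit : Finset U} {s : RState} {r : ℕ}
    (h : StoresSide idx idx' pref rank crit s r) :
    s.arr r (Fintype.card U) = ∑ u, (pref u).length := by
  have key : ∀ j ≤ Fintype.card U, s.arr r j =
      ∑ i ∈ Finset.range j, if hi : i < Fintype.card U then (pref (idx.symm ⟨i, hi⟩)).length
        else 0 := by
    intro j
    induction j with
    | zero => intro _; simpa using h.1
    | succ j ih =>
      intro hj
      have := h.2.1 (idx.symm ⟨j, hj⟩)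
      simp only [Equiv.apply_symm_apply] at this
      rw [Finset.sum_range_succ, this, ih (by omega), dif_pos (show j < Fintype.card U from hj)]
  rw [key _ le_rfl, Finset.sum_range, ← Equiv.sum_comp idx.symm]
  simp

theorem length_prefB_le (b : B) : (P.prefB b).length ≤ Fintype.card A :=
  (P.nodup_prefB b).length_le_card

theorem sum_length_prefA : ∑ a, (P.prefA a).length = I.edges.card := by
  classical
  have : ∀ a, (P.prefA a).length = (I.edges.filter fun e => e.1 = a).card := by
    intro a
    rw [← List.toFinset_card_of_nodup (P.nodup_prefA a)]
    apply Finset.card_bij (fun b _ => (a, b))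
    · intro b hb
      simpa [P.mem_prefA] using hb
    · intro b _ b' _ e
      simpa using e
    · rintro ⟨a', b⟩ he
      simp only [Finset.mem_filter] at he
      obtain ⟨he, rfl⟩ := he
      exact ⟨b, by simpa [P.mem_prefA] using he, rfl⟩
  rw [Finset.sum_congr rfl fun a _ => this a]
  exact (Finset.card_eq_sum_card_fiberwise fun _ _ => Finset.mem_coe.2 (Finset.mem_univ _)).symm

/-- The offsets are partial sums of the degrees, so the program finds `|E|` at the last one. -/
theorem Stored.arr_card {s : RState} (h : Stored P s) :
    s.arr 0 (Fintype.card A) = I.edges.card := by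
  rw [h.sideA.sum, sum_length_prefA]

theorem Stored.off_succ {s : RState} (h : Stored P s) (a : A) :
    s.arr 0 ((P.idxA a : ℕ) + 1) = s.arr 0 (P.idxA a : ℕ) + (P.prefA a).length := h.sideA.2.1 a

theorem Stored.off_le {s : RState} (h : Stored P s) {a c : A} (hac : (P.idxA c : ℕ) < P.idxA a) :
    s.arr 0 (P.idxA c : ℕ) + (P.prefA c).length ≤ s.arr 0 (P.idxA a : ℕ) := by
  rw [← h.off_succ]
  exact h.sideA.mono hac (P.idxA a).2.le

theorem Stored.nbr {s : RState} (h : Stored P s) {a : A} {b : B} {k : ℕ}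
    (hk : (P.prefA a)[k]? = some b) : s.arr 1 (s.arr 0 (P.idxA a : ℕ) + k) = P.idxB b :=
  (h.sideA.2.2.1 a k b hk).1

theorem Stored.rank {s : RState} (h : Stored P s) {a : A} {b : B} {k : ℕ}
    (hk : (P.prefA a)[k]? = some b) : s.arr 2 (s.arr 0 (P.idxA a : ℕ) + k) = I.rankA a b :=
  (h.sideA.2.2.1 a k b hk).2

theorem Stored.critA {s : RState} (h : Stored P s) (a : A) :
    s.arr 3 (P.idxA a : ℕ) ≠ 0 ↔ a ∈ I.critA := by
  have h1 := (h.sideA.2.2.2 a).1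
  have h2 := (h.sideA.2.2.2 a).2
  by_cases hc : a ∈ I.critA <;> simp_all

theorem Stored.critB {s : RState} (h : Stored P s) (b : B) :
    s.arr 7 (P.idxB b : ℕ) ≠ 0 ↔ b ∈ I.critB := by
  have h1 := (h.sideB.2.2.2 b).1
  have h2 := (h.sideB.2.2.2 b).2
  by_cases hc : b ∈ I.critB <;> simp_all

variable (P) in
/-- Array `9` holds, for every entry of the preference lists of the side `A`, twice the rank in
the opposite direction. -/
def StoresRanks (s : RState) (a : A) (n : ℕ) : Prop :=
  ∀ k b, k < n → (P.prefA a)[k]? = some b →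
    s.arr 9 (s.arr 0 (P.idxA a : ℕ) + k) = 2 * I.rankB b a

/-! ## Looking up the ranks of the side `B` -/

/-- Move register `4` to the entry of the vertex in register `2`. -/
def searchRank : RProg :=
  .loop (.add (.sub (.get 5 (.reg 4)) (.reg 2)) (.sub (.reg 2) (.get 5 (.reg 4))))
    (.set 4 (.add (.reg 4) (.lit 1)))

def rankRow : RProg :=
  .loop (.sub (.get 0 (.add (.reg 2) (.lit 1))) (.reg 3)) <|
    .seq (.set 4 (.get 4 (.get 1 (.reg 3)))) <|
    .seq searchRank <|
    .seq (.put 9 (.reg 3) (.add (.get 6 (.reg 4)) (.get 6 (.reg 4)))) <|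
    .set 3 (.add (.reg 3) (.lit 1))

/-- The lists of `A` do not say how `B` ranks their owner. A linear search costs `O(|A|)` per edge,
which the time bound allows. -/
def computeRanks : RProg :=
  .seq (.set 2 (.lit 0)) <|
  .loop (.sub (.reg 0) (.reg 2)) <|
    .seq (.set 3 (.get 0 (.reg 2))) <|
    .seq rankRow <|
    .set 2 (.add (.reg 2) (.lit 1))

/-- The search needs no bounds test because the edge guarantees that `a` occurs in the list of `b`.
-/
theorem searchRank_spec {s : RState} (hs : Stored P s) {a : A} {b : B}
    (he : (a, b) ∈ I.edges) (h2 : s.reg 2 = P.idxA a) (h4 : s.reg 4 = s.arr 4 (P.idxB b : ℕ)) :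
    Spec searchRank s fun k s' => k ≤ 15 * Fintype.card A + 10 ∧ Agree ∅ {4} s s' ∧
      s'.arr 6 (s'.reg 4) = I.rankB b a := by
  obtain ⟨j, hj⟩ := List.mem_iff_getElem?.1 ((P.mem_prefB b a).2 he)
  have hlt : j < (P.prefB b).length := (List.getElem?_eq_some_iff.1 hj).1
  have hcard := length_prefB_le (P := P) b
  have hpos := hs.sideB.2.2.1 b
  refine spec_loop (fun n s' => Agree ∅ {4} s s' ∧
    ∃ k ≤ j, s'.reg 4 = s.arr 4 (P.idxB b : ℕ) + k ∧ n = 15 * (j - k)) ?_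
    (n := 15 * j) ⟨Agree.refl _ _ _, 0, by omega, by simpa using h4, by simp⟩ ?_
  · rintro n s' ⟨ha, k, hk, hr, rfl⟩ hne
    have h2' : s'.reg 2 = P.idxA a := by rw [ha.reg 2 (by decide), h2]
    simp only [RExp.eval, hr, h2', ha.arr _ (Finset.notMem_empty _)] at hne
    have hkj : k ≠ j := by
      rintro rfl
      rw [(hpos _ _ hj).1] at hne
      simp at hne
    refine spec_set ⟨15 * (j - (k + 1)), ⟨ha.setReg (by decide) _, k + 1, by omega, ?_, rfl⟩, ?_⟩
    · simp [RExp.eval, hr]; omega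
    · simp only [RExp.cost]; omega
  · rintro m k s' ⟨ha, i, hi, hr, rfl⟩ hz hle
    have h2' : s'.reg 2 = P.idxA a := by rw [ha.reg 2 (by decide), h2]
    simp only [RExp.eval, hr, h2', ha.arr _ (Finset.notMem_empty _)] at hz
    refine ⟨by simp only [RExp.cost] at hle; omega, ha, ?_⟩
    obtain ⟨c, hc⟩ : ∃ c, (P.prefB b)[i]? = some c :=
      ⟨_, List.getElem?_eq_getElem (by omega)⟩
    have := hpos _ _ hc
    simp only [Nat.reduceAdd] at this
    rw [this.1] at hz
    have hca : c = a := idxA_inj (P := P).1 (by omega)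
    rw [hr, ha.arr _ (Finset.notMem_empty _), this.2, hca]

theorem rankRow_spec {s : RState} (hs : Stored P s) {a : A}
    (h2 : s.reg 2 = P.idxA a) (h3 : s.reg 3 = s.arr 0 (P.idxA a : ℕ)) :
    Spec rankRow s fun k s' => k ≤ (P.prefA a).length * (15 * Fintype.card A + 40) + 7 ∧
      Agree {9} {3, 4} s s' ∧ StoresRanks P s' a (P.prefA a).length ∧
      ∀ i < s.arr 0 (P.idxA a : ℕ), s'.arr 9 i = s.arr 9 i := by
  refine spec_loop (fun n s' => Agree {9} {3, 4} s s' ∧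
    (∀ i < s.arr 0 (P.idxA a : ℕ), s'.arr 9 i = s.arr 9 i) ∧
    ∃ k ≤ (P.prefA a).length, s'.reg 3 = s.arr 0 (P.idxA a : ℕ) + k ∧ StoresRanks P s' a k ∧
      n = ((P.prefA a).length - k) * (15 * Fintype.card A + 40)) ?_
    ⟨Agree.refl _ _ _, fun _ _ => rfl, 0, by omega, by simpa using h3, fun k b hk => by omega, rfl⟩ ?_
  · rintro n s' ⟨ha, hlow, k, hk, hr, hst, rfl⟩ hne
    have hs' : Stored P s' := hs.agree ha (by decide) (by decide) (by decide)
    have h0 : s'.arr 0 = s.arr 0 := ha.arr 0 (by decide)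
    have h2' : s'.reg 2 = P.idxA a := by rw [ha.reg 2 (by decide), h2]
    simp only [RExp.eval, hr, h2', h0, hs.off_succ] at hne
    obtain ⟨b, hb⟩ : ∃ b, (P.prefA a)[k]? = some b :=
      ⟨_, List.getElem?_eq_getElem (by omega)⟩
    have he : (a, b) ∈ I.edges := (P.mem_prefA a b).1 (List.mem_of_getElem? hb)
    refine spec_seq (spec_set (spec_seq ?_))
    set s₁ := s'.setReg 4 (RExp.eval s' (.get 4 (.get 1 (.reg 3)))) with hs₁
    have ha₁ : Agree {9} {3, 4} s' s₁ := (Agree.refl _ _ _).setReg (by decide) _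
    have hs₁' : Stored P s₁ := hs'.agree ha₁ (by decide) (by decide) (by decide)
    refine (searchRank_spec hs₁' he (by simp [hs₁, h2']) ?_).mono ?_
    · have := hs'.nbr hb
      rw [h0] at this
      simp [hs₁, RExp.eval, hr, this]
    rintro c s₂ ⟨hc, ha₂, hval⟩
    refine spec_seq (spec_put (spec_set ?_))
    have hr₂ : s₂.reg 3 = s.arr 0 (P.idxA a : ℕ) + k := by
      rw [ha₂.reg 3 (by decide)]
      simp [hs₁, hr]
    have ha₃ : Agree {9} {3, 4} s s₂ :=
      (ha.trans ha₁).trans (ha₂.mono (by decide) (by decide))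
    have h9 : s₂.arr 9 = s'.arr 9 := by rw [ha₂.arr 9 (by decide)]; simp [hs₁]
    have h02 : s₂.arr 0 = s.arr 0 := ha₃.arr 0 (by decide)
    refine ⟨_, ⟨(ha₃.setArr (by decide) _ _).setReg (by decide) _, ?_, k + 1, by omega, ?_, ?_, rfl⟩,
      ?_⟩
    · intro i hi
      have : i ≠ s.arr 0 (P.idxA a : ℕ) + k := by omega
      simp [RExp.eval, hr₂, this, h9, hlow i hi]
    · simp [RExp.eval, hr₂]; omega
    · intro i b' hi hb'
      rcases Nat.lt_succ_iff_lt_or_eq.1 hi with hi | rfl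
      · have := hst i b' hi hb'
        rw [h0] at this
        simp [RExp.eval, hr₂, h02, hi.ne, h9, this]
      · rw [hb] at hb'
        cases hb'
        simp [RExp.eval, hr₂, h02, hval]; omega
    · simp only [RExp.cost]
      have : (P.prefA a).length - k = ((P.prefA a).length - (k + 1)) + 1 := by omega
      rw [this, add_mul]
      omega
  · rintro m k s' ⟨ha, hlow, i, hi, hr, hst, rfl⟩ hz hle
    have h0 : s'.arr 0 = s.arr 0 := ha.arr 0 (by decide)
    have h2' : s'.reg 2 = P.idxA a := by rw [ha.reg 2 (by decide), h2]
    simp only [RExp.eval, hr, h2', h0, hs.off_succ] at hz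
    have : i = (P.prefA a).length := by omega
    subst this
    refine ⟨?_, ha, hst, hlow⟩
    simp only [RExp.cost] at hle
    simp at hle
    omega

theorem computeRanks_spec {s : RState} (hs : Stored P s) :
    Spec computeRanks s fun k s' =>
      k ≤ I.edges.card * (15 * Fintype.card A + 40) + 25 * Fintype.card A + 6 ∧
      Agree {9} {2, 3, 4} s s' ∧ ∀ a, StoresRanks P s' a (P.prefA a).length := by
  refine spec_seq (spec_set ?_)
  -- The difference of offsets counts the edges in the rows still to be processed, so the costs of
  -- the rows telescope.
  refine spec_loop (fun n s' => Agree {9} {2, 3, 4} s s' ∧ s'.reg 2 ≤ Fintype.card A ∧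
      (∀ a, (P.idxA a : ℕ) < s'.reg 2 → StoresRanks P s' a (P.prefA a).length) ∧
      n = (I.edges.card - s.arr 0 (s'.reg 2)) * (15 * Fintype.card A + 40) +
        25 * (Fintype.card A - s'.reg 2)) ?_
    (n := I.edges.card * (15 * Fintype.card A + 40) + 25 * Fintype.card A)
    ⟨(Agree.refl _ _ _).setReg (by decide) _, by simp [RExp.eval], by simp [RExp.eval],
      by simp [RExp.eval, hs.sideA.1]⟩ ?_
  · rintro n s' ⟨ha, hle, hst, rfl⟩ hne
    have hs' : Stored P s' := hs.agree ha (by decide) (by decide) (by decide)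
    simp only [RExp.eval, hs'.cardA] at hne
    obtain ⟨a, h2⟩ := exists_idxA (P := P) (i := s'.reg 2) (by omega)
    have h0 : s'.arr 0 = s.arr 0 := ha.arr 0 (by decide)
    refine spec_seq (spec_set (spec_seq ?_))
    set s₁ := s'.setReg 3 (RExp.eval s' (.get 0 (.reg 2))) with hs₁
    have ha₁ : Agree {9} {2, 3, 4} s' s₁ := (Agree.refl _ _ _).setReg (by decide) _
    have hs₁' : Stored P s₁ := hs'.agree ha₁ (by decide) (by decide) (by decide)
    refine (rankRow_spec hs₁' (a := a) (by simp [hs₁, h2]) (by simp [hs₁, RExp.eval, h2])).mono ?_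
    rintro c s₂ ⟨hc, ha₂, hrow, hlow⟩
    have ha₃ : Agree {9} {2, 3, 4} s s₂ :=
      (ha.trans ha₁).trans (ha₂.mono (by decide) (by decide))
    have hr₂ : s₂.reg 2 = P.idxA a := by
      rw [ha₂.reg 2 (by decide)]
      simp [hs₁, h2]
    have h02 : s₂.arr 0 = s.arr 0 := ha₃.arr 0 (by decide)
    refine spec_set ⟨_, ⟨ha₃.setReg (by decide) _, ?_, ?_, rfl⟩, ?_⟩
    · simp [RExp.eval, hr₂]
    · intro d hd
      simp only [RExp.eval, reg_setReg, if_true, hr₂] at hd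
      rcases Nat.lt_succ_iff_lt_or_eq.1 hd with hd | hd
      · intro k b hk hb
        have hle := hs.off_le hd
        have := hst d (by omega) k b hk hb
        rw [h0] at this
        rw [arr_setReg, h02, hlow _ (by simp [hs₁, h0]; omega)]
        simpa [hs₁] using this
      · obtain rfl := idxA_inj.1 hd
        exact hrow
    · have hsucc := hs.off_succ a
      have hmono := hs.sideA.mono (show (P.idxA a : ℕ) + 1 ≤ _ from (P.idxA a).2) le_rfl
      rw [hs.arr_card] at hmono
      simp only [RExp.eval, RExp.cost, reg_setReg, if_true, hr₂, ← h2]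
      have : I.edges.card - s.arr 0 (P.idxA a : ℕ) =
        (I.edges.card - s.arr 0 ((P.idxA a : ℕ) + 1)) + (P.prefA a).length := by omega
      rw [this, add_mul]
      omega
  · rintro m k s' ⟨ha, hle, hst, -⟩ hz hcost
    have hs' : Stored P s' := hs.agree ha (by decide) (by decide) (by decide)
    simp only [RExp.eval, hs'.cardA] at hz
    refine ⟨?_, ha, fun a => hst a ?_⟩
    · simp only [RExp.cost] at hcost ⊢
      omega
    · have := (P.idxA a).2
      omega

end Input

section Generate

variable {A B : Type*} [Fintype A] [Fintype B] {I : MarriageInstance A B} (P : Presentation I)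

/-! ## Writing down the lists of offers -/

/-- The arrays `10`, `11`, `12` hold the offers in `l`, from the position `base` on. -/
def StoresOffers (s : RState) (base : ℕ) (l : List (Offer B)) : Prop :=
  ∀ k o, l[k]? = some o → s.arr 10 (base + k) = P.idxB o.dest ∧
    s.arr 11 (base + k) = o.cls ∧ s.arr 12 (base + k) = o.key

/-- The complete list of offers of `a` is stored from the position `s.arr 13 (idxA a)` on, and
ends where the list of the next vertex starts. -/
structure StoresList (s : RState) (a : A) (l : List (Offer B)) : Prop where
  valid : ValidList I a l
  complete : CompleteList I a l
  length_le : l.length ≤ (P.prefA a).length * (Fintype.card A + Fintype.card B + 3)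
  next : s.arr 13 ((P.idxA a : ℕ) + 1) = s.arr 13 (P.idxA a : ℕ) + l.length
  stored : StoresOffers P s (s.arr 13 (P.idxA a : ℕ)) l

/-- The state `s'` in which the offers `l` of the vertex `a` have been written, when the work
started in the state `s`. -/
structure Writing (s s' : RState) (a : A) (l : List (Offer B)) : Prop where
  agree : Agree {10, 11, 12, 13} {2, 3, 4, 5, 6, 7, 8, 9} s s'
  vertex : s'.reg 2 = P.idxA a
  limit : s'.reg 9 = s.arr 0 (P.idxA a : ℕ) + (P.prefA a).length
  before : ∀ c, (P.idxA c : ℕ) < P.idxA a →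
    s'.arr 13 ((P.idxA c : ℕ) + 1) ≤ s'.reg 5 ∧ ∃ l, StoresList P s' c l
  pos : s'.reg 5 = s'.arr 13 (P.idxA a : ℕ) + l.length
  stored : StoresOffers P s' (s'.arr 13 (P.idxA a : ℕ)) l
  valid : ValidList I a l

/-- Write an offer of class register `7` and key register `8` to the vertex whose entry in the
preference list is at register `3`. -/
def emit : RProg :=
  .seq (.put 10 (.reg 5) (.get 1 (.reg 3))) <|
  .seq (.put 11 (.reg 5) (.reg 7)) <|
  .seq (.put 12 (.reg 5) (.reg 8)) <|
  .set 5 (.add (.reg 5) (.lit 1))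

/-- Write the plain offers of class register `7` to all neighbours that satisfy `cond`. -/
def pass (cond : RExp) : RProg :=
  .seq (.set 3 (.get 0 (.reg 2))) <|
  .loop (.sub (.reg 9) (.reg 3)) <|
    .seq (.ite cond (.seq (.set 8 (.get 9 (.reg 3))) emit) .skip) <|
    .set 3 (.add (.reg 3) (.lit 1))

def lowRounds : RProg :=
  .seq (.set 4 (.lit 0)) <|
  .loop (.sub (.reg 1) (.reg 4)) <|
    .seq (.set 7 (.reg 4)) <|
    .seq (pass (.get 7 (.get 1 (.reg 3)))) <|
    .set 4 (.add (.reg 4) (.lit 1))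

/-- The test whether the next provisional offer, at register `4`, comes before the next firm one,
at register `6`. -/
def provisionalTest : RExp :=
  .sub (.lit 1) (.add (.sub (.lit 1) (.sub (.reg 9) (.reg 4)))
    (.sub (.lit 1) (.sub (.add (.get 2 (.reg 6)) (.lit 1)) (.get 2 (.reg 4)))))

def mergeRound : RProg :=
  .seq (.set 4 (.get 0 (.reg 2))) <|
  .seq (.set 6 (.get 0 (.reg 2))) <|
  .loop (.sub (.reg 9) (.reg 6)) <|
    .ite provisionalTest
      (.seq (.set 3 (.reg 4)) <|
       .seq (.set 7 (.reg 1)) <|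
       .seq (.set 8 (.get 9 (.reg 3))) <|
       .seq emit <|
       .set 4 (.add (.reg 4) (.lit 1)))
      (.seq (.set 3 (.reg 6)) <|
       .seq (.set 7 (.add (.reg 1) (.lit 1))) <|
       .seq (.set 8 (.add (.get 9 (.reg 3)) (.lit 1))) <|
       .seq emit <|
       .set 6 (.add (.reg 6) (.lit 1)))

/-- Register `4` counts the remaining rounds and register `7` is the current class. -/
def highRounds : RProg :=
  .loop (.reg 4) <|
    .seq (pass (.lit 1)) <|
    .seq (.set 7 (.add (.reg 7) (.lit 1))) <|
    .set 4 (.sub (.reg 4) (.lit 1))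

def writeList : RProg :=
  .seq lowRounds <|
  .seq mergeRound <|
  .seq (.set 7 (.add (.reg 1) (.lit 1))) <|
  .seq (.set 4 (.lit 1)) <|
  .seq (.ite (.get 3 (.reg 2)) (.set 4 (.add (.reg 0) (.lit 1))) .skip) <|
  highRounds

/-- Vertices without neighbours are skipped: their empty rounds alone could cost `|A| |B|` steps,
which is not `O(n |E|)`. -/
def writeLists : RProg :=
  .seq (.set 2 (.lit 0)) <|
  .loop (.sub (.reg 0) (.reg 2)) <|
    .seq (.set 9 (.get 0 (.add (.reg 2) (.lit 1)))) <|
    .seq (.ite (.sub (.reg 9) (.get 0 (.reg 2))) writeList .skip) <|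
    .seq (.set 2 (.add (.reg 2) (.lit 1))) <|
    .put 13 (.reg 2) (.reg 5)

variable {P} {s s' : RState} {a : A} {l : List (Offer B)}

theorem Writing.setReg (h : Writing P s s' a l) {x : ℕ} (hx : x ∈ ({3, 4, 6, 7, 8} : Finset ℕ))
    (v : ℕ) : Writing P s (s'.setReg x v) a l := by
  have h2 : x ≠ 2 := by rintro rfl; simp at hx
  have h5 : x ≠ 5 := by rintro rfl; simp at hx
  have h9 : x ≠ 9 := by rintro rfl; simp at hx
  constructor
  · exact h.agree.setReg ((show ({3, 4, 6, 7, 8} : Finset ℕ) ⊆ _ by decide) hx) v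
  · simp [h2.symm, h.vertex]
  · simp [h9.symm, h.limit]
  · simp only [arr_setReg, reg_setReg, h5.symm, if_false]
    intro c hc
    obtain ⟨h1, l, h2⟩ := h.before c hc
    exact ⟨h1, l, h2.1, h2.2, h2.3, h2.4, h2.5⟩
  · simp [h5.symm, h.pos]
  · exact h.stored
  · exact h.valid

theorem emit_spec (hs : Stored P s) (h : Writing P s s' a l) {k : ℕ} {o : Offer B}
    (hk : (P.prefA a)[k]? = some o.dest) (h3 : s'.reg 3 = s.arr 0 (P.idxA a : ℕ) + k)
    (h7 : s'.reg 7 = o.cls) (h8 : s'.reg 8 = o.key) (ho : Valid I a l o) :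
    Spec emit s' fun c t => c = 14 ∧ Writing P s t a (l ++ [o]) ∧
      ∀ x, x ≠ 5 → t.reg x = s'.reg x := by
  have h1 : s'.arr 1 (s'.reg 3) = P.idxB o.dest := by
    rw [h.agree.arr 1 (by decide), h3, hs.nbr hk]
  refine spec_seq (spec_put (spec_seq (spec_put (spec_seq (spec_put (spec_set ?_))))))
  refine ⟨by simp [RExp.cost], ⟨?_, ?_, ?_, ?_, ?_, ?_, h.valid.append ho⟩, ?_⟩
  · exact (((h.agree.setArr (by decide) _ _).setArr (by decide) _ _).setArr (by decide) _ _).setReg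
      (by decide) _
  · simp [h.vertex]
  · simp [h.limit]
  · intro c hc
    obtain ⟨hle, l', hl'⟩ := h.before c hc
    refine ⟨by simp [RExp.eval]; omega, l', hl'.1, hl'.2, hl'.3, by simp [hl'.4], ?_⟩
    intro j x hj
    have hlt := (List.getElem?_eq_some_iff.1 hj).1
    -- Earlier lists end at or before the writing position, so they are not overwritten.
    have hne : s'.arr 13 (P.idxA c : ℕ) + j ≠ s'.reg 5 := by
      have := hl'.4
      omega
    simpa [RExp.eval, hne] using hl'.5 j x hj
  · simp [RExp.eval, h.pos]; omega
  · intro j x hj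
    rcases lt_trichotomy j l.length with hlt | rfl | hgt
    · rw [List.getElem?_append_left hlt] at hj
      have hne : s'.arr 13 (P.idxA a : ℕ) + j ≠ s'.reg 5 := by
        have := h.pos
        omega
      simpa [RExp.eval, hne] using h.stored j x hj
    · rw [List.getElem?_append_right le_rfl] at hj
      simp only [Nat.sub_self, List.getElem?_cons_zero, Option.some.injEq] at hj
      subst hj
      have := h.pos
      simp [RExp.eval, ← this, h1, h7, h8]
    · rw [List.getElem?_eq_none (by simp; omega)] at hj
      cases hj
  · intro x hx
    simp [hx]

/-- Serves both the low and the high rounds. Offers of one round do not depend on each other, so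
validity is only needed after the list `l` present at its start. -/
theorem pass_spec (hs : Stored P s) (hrk : ∀ a, StoresRanks P s a (P.prefA a).length)
    (h : Writing P s s' a l) {cond : RExp} (hcost : cond.cost ≤ 3) {q : B → Prop} {r : ℕ}
    (h7 : s'.reg 7 = r)
    (hcond : ∀ t k b, Agree {10, 11, 12, 13} {2, 3, 4, 5, 6, 7, 8, 9} s t →
      t.reg 3 = s.arr 0 (P.idxA a : ℕ) + k → (P.prefA a)[k]? = some b → (cond.eval t ≠ 0 ↔ q b))
    (hv : ∀ b, (a, b) ∈ I.edges → q b → Valid I a l (plainOffer I a b r)) :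
    Spec (pass cond) s' fun c t => c ≤ 40 * (P.prefA a).length + 10 ∧
      (∃ l', l ⊆ l' ∧ Writing P s t a l' ∧ l'.length ≤ l.length + (P.prefA a).length ∧
        ∀ b, (a, b) ∈ I.edges → q b → plainOffer I a b r ∈ l') ∧
      ∀ x, x ≠ 3 → x ≠ 5 → x ≠ 8 → t.reg x = s'.reg x := by
  refine spec_seq (spec_set (spec_loop (fun n t =>
    (∀ x, x ≠ 3 → x ≠ 5 → x ≠ 8 → t.reg x = s'.reg x) ∧
    ∃ k l', l ⊆ l' ∧ Writing P s t a l' ∧ l'.length ≤ l.length + k ∧ k ≤ (P.prefA a).length ∧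
      t.reg 3 = s.arr 0 (P.idxA a : ℕ) + k ∧
      (∀ i < k, ∀ b, (P.prefA a)[i]? = some b → q b → plainOffer I a b r ∈ l') ∧
      n = 40 * ((P.prefA a).length - k)) ?_
    ⟨?_, 0, l, List.Subset.refl _, h.setReg (by decide) _, by omega, by omega, ?_, by simp, rfl⟩ ?_))
  · rintro n t ⟨hreg, k, l', hsub, hw, hlen, hk, h3, hin, rfl⟩ hne
    simp only [RExp.eval, hw.limit, h3] at hne
    obtain ⟨b, hb⟩ : ∃ b, (P.prefA a)[k]? = some b :=
      ⟨_, List.getElem?_eq_getElem (by omega)⟩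
    have he : (a, b) ∈ I.edges := (P.mem_prefA a b).1 (List.mem_of_getElem? hb)
    have hq := hcond t k b hw.agree h3 hb
    have fin : ∀ (l'' : List (Offer B)) (u : RState) (c : ℕ), l' ⊆ l'' → Writing P s u a l'' →
        l''.length ≤ l'.length + 1 → (∀ x, x ≠ 3 → x ≠ 5 → x ≠ 8 → u.reg x = t.reg x) →
        u.reg 3 = t.reg 3 → (q b → plainOffer I a b r ∈ l'') → c ≤ 25 →
        Spec (.set 3 (.add (.reg 3) (.lit 1))) u fun d v => ∃ m,
          ((∀ x, x ≠ 3 → x ≠ 5 → x ≠ 8 → v.reg x = s'.reg x) ∧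
          ∃ k l', l ⊆ l' ∧ Writing P s v a l' ∧ l'.length ≤ l.length + k ∧
            k ≤ (P.prefA a).length ∧ v.reg 3 = s.arr 0 (P.idxA a : ℕ) + k ∧
            (∀ i < k, ∀ b, (P.prefA a)[i]? = some b → q b → plainOffer I a b r ∈ l') ∧
            m = 40 * ((P.prefA a).length - k)) ∧
          m + (c + d) + (RExp.sub (.reg 9) (.reg 3)).cost + 1 ≤
            40 * ((P.prefA a).length - k) := by
      intro l'' u c hsub' hw' hlen' hreg' h3' hin' hc
      refine spec_set ⟨_, ⟨?_, k + 1, l'', List.Subset.trans hsub hsub', hw'.setReg (by decide) _, by omega,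
        by omega, ?_, ?_, rfl⟩, ?_⟩
      · intro x hx3 hx5 hx8
        simp [hx3, hreg' x hx3 hx5 hx8, hreg x hx3 hx5 hx8]
      · simp [RExp.eval, h3', h3]; omega
      · intro i hi b' hb' hqb
        rcases Nat.lt_succ_iff_lt_or_eq.1 hi with hi | rfl
        · exact hsub' (hin i hi b' hb' hqb)
        · rw [hb] at hb'
          cases hb'
          exact hin' hqb
      · simp only [RExp.cost]
        omega
    refine spec_seq (spec_ite (fun hc => ?_) fun hc => ?_)
    · refine spec_seq (spec_set ((emit_spec (k := k) (o := plainOffer I a b r) hs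
        (hw.setReg (by decide) _) hb ?_ ?_ ?_ ((hv b he (hq.1 hc)).mono hsub)).mono ?_))
      · simpa using h3
      · simp [hreg 7, h7, plainOffer]
      · simp only [RExp.eval, reg_setReg, if_true, plainOffer]
        rw [hw.agree.arr 9 (by decide), h3]
        exact hrk a k b (by omega) hb
      · rintro c u ⟨rfl, hwu, hru⟩
        refine fin _ u _ (List.subset_append_left _ _) hwu (by simp) (fun x h3 h5 h8 => ?_) ?_ ?_ ?_
        · rw [hru x h5, reg_setReg, if_neg h8]
        · rw [hru 3 (by decide), reg_setReg, if_neg (by decide)]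
        · simp
        · simp only [RExp.cost]; omega
    · refine spec_skip (fin l' t _ (List.Subset.refl _) hw (by omega) (fun _ _ _ _ => rfl) rfl
        (fun h => absurd hc (hq.2 h)) (by omega))
  · intro x hx _ _
    simp [hx]
  · simp [RExp.eval, h.vertex, h.agree.arr 0]
  · rintro m c t ⟨hreg, k, l', hsub, hw, hlen, hk, h3, hin, rfl⟩ hz hcost
    simp only [RExp.eval, hw.limit, h3] at hz
    have : k = (P.prefA a).length := by omega
    subst this
    simp only [RExp.cost] at hcost ⊢
    refine ⟨by omega, ⟨l', hsub, hw, hlen, fun b he hqb => ?_⟩, hreg⟩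
    obtain ⟨i, hi⟩ := List.mem_iff_getElem?.1 ((P.mem_prefA a b).2 he)
    exact hin i (List.getElem?_eq_some_iff.1 hi).1 b hi hqb

theorem lowRounds_spec (hs : Stored P s) (hrk : ∀ a, StoresRanks P s a (P.prefA a).length)
    (h : Writing P s s' a []) :
    Spec lowRounds s' fun c t => c ≤ Fintype.card B * (40 * (P.prefA a).length + 30) + 6 ∧
      ∃ l', Writing P s t a l' ∧ l'.length ≤ Fintype.card B * (P.prefA a).length ∧
        LowDone I a l' (Fintype.card B) := by
  refine spec_seq (spec_set (spec_loop (fun n t =>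
    ∃ l', Writing P s t a l' ∧ l'.length ≤ t.reg 4 * (P.prefA a).length ∧
      t.reg 4 ≤ Fintype.card B ∧ LowDone I a l' (t.reg 4) ∧
      n = (Fintype.card B - t.reg 4) * (40 * (P.prefA a).length + 30)) ?_
    ⟨[], h.setReg (by decide) _, by simp, by simp [RExp.eval], ?_, rfl⟩ ?_))
  · rintro n t ⟨l', hw, hlen, hr, hlow, rfl⟩ hne
    have ht : Stored P t := hs.agree hw.agree (by decide) (by decide) (by decide)
    simp only [RExp.eval, ht.cardB] at hne
    refine spec_seq (spec_set (spec_seq ((pass_spec (q := (· ∈ I.critB)) (r := t.reg 4) hs hrk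
      (hw.setReg (by decide) _) (by simp [RExp.cost]) (by simp [RExp.eval]) ?_ ?_).mono ?_)))
    · intro u k b hu h3 hb
      simp only [RExp.eval, h3]
      rw [hu.arr 1 (by decide), hu.arr 7 (by decide), hs.nbr hb, hs.critB]
    · exact fun b he hb => .low _ b (by omega) hb he hlow
    · rintro c u ⟨hc, ⟨l'', hsub, hwu, hlen', hin⟩, hreg⟩
      have h4 : u.reg 4 = t.reg 4 := by simp [hreg 4]
      refine spec_set ⟨_, ⟨l'', hwu.setReg (by decide) _, ?_, ?_, ?_, rfl⟩, ?_⟩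
      · simp only [RExp.eval, reg_setReg, if_true, h4, add_mul]
        omega
      · simp only [RExp.eval, reg_setReg, if_true, h4]
        omega
      · simp only [RExp.eval, reg_setReg, if_true, h4]
        intro i hi b hb he
        rcases Nat.lt_succ_iff_lt_or_eq.1 hi with hi | rfl
        · exact hsub (hlow i hi b hb he)
        · exact hin b he hb
      · simp only [RExp.eval, RExp.cost, reg_setReg, if_true, h4]
        have : Fintype.card B - t.reg 4 = (Fintype.card B - (t.reg 4 + 1)) + 1 := by omega
        rw [this, add_mul]
        omega
  · intro i hi
    simp [RExp.eval] at hi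
  · rintro m c t ⟨l', hw, hlen, hr, hlow, rfl⟩ hz hcost
    have ht : Stored P t := hs.agree hw.agree (by decide) (by decide) (by decide)
    simp only [RExp.eval, ht.cardB] at hz
    have h4 : t.reg 4 = Fintype.card B := by omega
    rw [h4] at hlen hlow
    simp only [RExp.eval, RExp.cost, reg_setReg, if_true, Nat.sub_zero] at hcost ⊢
    exact ⟨by omega, l', hw, hlen, hlow⟩

theorem mergeRound_spec (hs : Stored P s) (hrk : ∀ a, StoresRanks P s a (P.prefA a).length)
    (h : Writing P s s' a l) (hlow : LowDone I a l (Fintype.card B)) :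
    Spec mergeRound s' fun c t => c ≤ 120 * (P.prefA a).length + 10 ∧
      ∃ l', l ⊆ l' ∧ Writing P s t a l' ∧ l'.length ≤ l.length + 2 * (P.prefA a).length ∧
        HighDone I a l' 0 := by
  refine spec_seq (spec_set (spec_seq (spec_set (spec_loop (fun n t =>
    ∃ l' i j, l ⊆ l' ∧ Writing P s t a l' ∧ l'.length ≤ l.length + i + j ∧
      i ≤ (P.prefA a).length ∧ j ≤ (P.prefA a).length ∧
      t.reg 4 = s.arr 0 (P.idxA a : ℕ) + i ∧ t.reg 6 = s.arr 0 (P.idxA a : ℕ) + j ∧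
      (∀ i' < i, ∀ b, (P.prefA a)[i']? = some b → plainOffer I a b (Fintype.card B) ∈ l') ∧
      (∀ j' < j, ∀ b, (P.prefA a)[j']? = some b → firmOffer I a b ∈ l') ∧
      n = 60 * ((P.prefA a).length - i) + 60 * ((P.prefA a).length - j)) ?_
    ⟨l, 0, 0, List.Subset.refl _, (h.setReg (by decide) _).setReg (by decide) _, by omega,
      by omega, by omega, ?_, ?_, by simp, by simp, rfl⟩ ?_))))
  · rintro n t ⟨l', i, j, hsub, hw, hlen, hi, hj, h4, h6, hprov, hfirm, rfl⟩ hne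
    have ht : Stored P t := hs.agree hw.agree (by decide) (by decide) (by decide)
    have hl' := hlow.mono le_rfl hsub
    simp only [RExp.eval, hw.limit, h6] at hne
    obtain ⟨b, hb⟩ : ∃ b, (P.prefA a)[j]? = some b :=
      ⟨_, List.getElem?_eq_getElem (by omega)⟩
    have heb : (a, b) ∈ I.edges := (P.mem_prefA a b).1 (List.mem_of_getElem? hb)
    have hle : ∀ (x y : ℕ) (b b' : B), x ≤ y → (P.prefA a)[x]? = some b → (P.prefA a)[y]? = some b' →
        I.rankA a b ≤ I.rankA a b' := by
      intro x y b b' hxy hx hy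
      obtain ⟨hx1, rfl⟩ := List.getElem?_eq_some_iff.1 hx
      obtain ⟨hy1, rfl⟩ := List.getElem?_eq_some_iff.1 hy
      rcases hxy.eq_or_lt with rfl | hxy
      · exact le_rfl
      · exact List.pairwise_iff_getElem.1 (P.sorted_prefA a) x y hx1 hy1 hxy
    -- In a sorted list, strictly better neighbours stand before position `j`.
    have hfirm' : ∀ b', (a, b') ∈ I.edges → I.rankA a b' < I.rankA a b → firmOffer I a b' ∈ l' := by
      intro b' he hlt
      obtain ⟨x, hx⟩ := List.mem_iff_getElem?.1 ((P.mem_prefA a b').2 he)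
      refine hfirm x ?_ b' hx
      by_contra hn
      have := hle j x b b' (by omega) hb hx
      omega
    have h2 : t.arr 2 (s.arr 0 (P.idxA a : ℕ) + j) = I.rankA a b := by
      rw [hw.agree.arr 2 (by decide), hs.rank hb]
    refine spec_ite (fun hc => ?_) fun hc => ?_
    · simp only [provisionalTest, RExp.eval, hw.limit, h4, h6, h2] at hc
      have hlt : i < (P.prefA a).length := by omega
      obtain ⟨d, hd⟩ : ∃ d, (P.prefA a)[i]? = some d :=
        ⟨_, List.getElem?_eq_getElem hlt⟩
      have hed : (a, d) ∈ I.edges := (P.mem_prefA a d).1 (List.mem_of_getElem? hd)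
      have h2' : t.arr 2 (s.arr 0 (P.idxA a : ℕ) + i) = I.rankA a d := by
        rw [hw.agree.arr 2 (by decide), hs.rank hd]
      rw [h2'] at hc
      refine spec_seq (spec_set (spec_seq (spec_set (spec_seq (spec_set (spec_seq
        ((emit_spec (k := i) (o := plainOffer I a d (Fintype.card B)) hs
          (((hw.setReg (by decide) _).setReg (by decide) _).setReg (by decide) _) hd
          ?_ ?_ ?_ (.provisional d hed hl' fun b' he hlt => hfirm' b' he (by omega))).mono ?_)))))))
      · simp [RExp.eval, h4]
      · simp [RExp.eval, plainOffer, ht.cardB]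
      · simp only [RExp.eval, reg_setReg, if_true, plainOffer, arr_setReg]
        rw [hw.agree.arr 9 (by decide)]
        simpa [h4] using hrk a i d hlt hd
      · rintro c u ⟨rfl, hwu, hru⟩
        refine spec_set ⟨_, ⟨l' ++ [plainOffer I a d (Fintype.card B)], i + 1, j,
          List.Subset.trans hsub (List.subset_append_left _ _), hwu.setReg (by decide) _, by simp; omega,
          by omega, hj, ?_, ?_, ?_, ?_, rfl⟩, ?_⟩
        · simp [RExp.eval, hru 4, h4]; omega
        · simp [hru 6, h6]
        · intro x hx y hy
          rcases Nat.lt_succ_iff_lt_or_eq.1 hx with hx | rfl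
          · exact List.mem_append_left _ (hprov x hx y hy)
          · rw [hd] at hy
            cases hy
            simp
        · exact fun x hx y hy => List.mem_append_left _ (hfirm x hx y hy)
        · simp only [RExp.cost, provisionalTest]
          omega
    · simp only [provisionalTest, RExp.eval, hw.limit, h4, h6, h2] at hc
      refine spec_seq (spec_set (spec_seq (spec_set (spec_seq (spec_set (spec_seq
        ((emit_spec (k := j) (o := firmOffer I a b) hs
          (((hw.setReg (by decide) _).setReg (by decide) _).setReg (by decide) _) hb
          ?_ ?_ ?_ (.firm b heb hl' hfirm' ?_)).mono ?_)))))))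
      · simp [RExp.eval, h6]
      · simp [RExp.eval, firmOffer, ht.cardB]
      · simp only [RExp.eval, reg_setReg, if_true, firmOffer, arr_setReg]
        rw [hw.agree.arr 9 (by decide)]
        simpa [h6] using hrk a j b (by omega) hb
      · intro b' he hrank
        obtain ⟨x, hx⟩ := List.mem_iff_getElem?.1 ((P.mem_prefA a b').2 he)
        have hxlt := (List.getElem?_eq_some_iff.1 hx).1
        refine hprov x ?_ b' hx
        by_contra hn
        obtain ⟨d, hd⟩ : ∃ d, (P.prefA a)[i]? = some d :=
          ⟨_, List.getElem?_eq_getElem (by omega)⟩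
        rw [hw.agree.arr 2 (by decide), hs.rank hd] at hc
        have := hle i x d b' (by omega) hd hx
        omega
      · rintro c u ⟨rfl, hwu, hru⟩
        refine spec_set ⟨_, ⟨l' ++ [firmOffer I a b], i, j + 1,
          List.Subset.trans hsub (List.subset_append_left _ _), hwu.setReg (by decide) _, by simp; omega,
          hi, by omega, ?_, ?_, ?_, ?_, rfl⟩, ?_⟩
        · simp [hru 4, h4]
        · simp [RExp.eval, hru 6, h6]; omega
        · exact fun x hx y hy => List.mem_append_left _ (hprov x hx y hy)
        · intro x hx y hy
          rcases Nat.lt_succ_iff_lt_or_eq.1 hx with hx | rfl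
          · exact List.mem_append_left _ (hfirm x hx y hy)
          · rw [hb] at hy
            cases hy
            simp
        · simp only [RExp.cost, provisionalTest]
          omega
  · simp [RExp.eval, h.vertex, h.agree.arr 0]
  · simp [RExp.eval, h.vertex, h.agree.arr 0]
  · rintro m c t ⟨l', i, j, hsub, hw, hlen, hi, hj, h4, h6, hprov, hfirm, rfl⟩ hz hcost
    simp only [RExp.eval, hw.limit, h6] at hz
    simp only [RExp.cost] at hcost ⊢
    refine ⟨by omega, l', hsub, hw, by omega, fun b he => ?_, by simp⟩
    obtain ⟨x, hx⟩ := List.mem_iff_getElem?.1 ((P.mem_prefA a b).2 he)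
    have hxlt := (List.getElem?_eq_some_iff.1 hx).1
    exact hfirm x (by omega) b hx

theorem highRounds_spec (hs : Stored P s) (hrk : ∀ a, StoresRanks P s a (P.prefA a).length)
    (h : Writing P s s' a l) (hlow : LowDone I a l (Fintype.card B)) (hhigh : HighDone I a l 0)
    (h7 : s'.reg 7 = Fintype.card B + 1) (hcrit : 1 < s'.reg 4 → a ∈ I.critA) :
    Spec highRounds s' fun c t => c ≤ s'.reg 4 * (40 * (P.prefA a).length + 30) + 2 ∧
      ∃ l', Writing P s t a l' ∧ l'.length ≤ l.length + s'.reg 4 * (P.prefA a).length ∧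
        LowDone I a l' (Fintype.card B) ∧ HighDone I a l' (s'.reg 4) := by
  refine spec_loop (fun n t => ∃ l' r, r + t.reg 4 = s'.reg 4 ∧ Writing P s t a l' ∧
    l'.length ≤ l.length + r * (P.prefA a).length ∧ t.reg 7 = Fintype.card B + 1 + r ∧
    LowDone I a l' (Fintype.card B) ∧ HighDone I a l' r ∧
    n = t.reg 4 * (40 * (P.prefA a).length + 30)) ?_
    ⟨l, 0, by simp, h, by simp, by simpa using h7, hlow, hhigh, rfl⟩ ?_
  · rintro n t ⟨l', r, hr, hw, hlen, h7, hlow, hhigh, rfl⟩ hne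
    simp only [RExp.eval] at hne
    refine spec_seq ((pass_spec (q := fun _ => True) (r := Fintype.card B + 1 + r) hs hrk hw
      (by simp [RExp.cost]) h7 ?_ ?_).mono ?_)
    · simp [RExp.eval]
    · exact fun b he _ => .high r b he hlow hhigh fun h0 => hcrit (by omega)
    · rintro c u ⟨hc, ⟨l'', hsub, hwu, hlen', hin⟩, hreg⟩
      have h4' : u.reg 4 = t.reg 4 := hreg 4 (by decide) (by decide) (by decide)
      have h7' : u.reg 7 = t.reg 7 := hreg 7 (by decide) (by decide) (by decide)
      refine spec_seq (spec_set (spec_set ⟨_, ⟨l'', r + 1, ?_,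
        (hwu.setReg (by decide) _).setReg (by decide) _, ?_, ?_, hlow.mono le_rfl hsub,
        ⟨fun b he => hsub (hhigh.1 b he), ?_⟩, rfl⟩, ?_⟩))
      · simp [RExp.eval, h4']; omega
      · simp only [add_mul]
        omega
      · simp [RExp.eval, h7', h7]; omega
      · intro i hi b he
        rcases Nat.lt_succ_iff_lt_or_eq.1 hi with hi | rfl
        · exact hsub (hhigh.2 i hi b he)
        · exact hin b he trivial
      · have : t.reg 4 = (t.reg 4 - 1) + 1 := by omega
        simp only [RExp.eval, RExp.cost, reg_setReg, if_true, if_false, h4',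
          show (4 : ℕ) ≠ 7 by decide]
        conv_rhs => rw [this, add_mul]
        omega
  · rintro m c t ⟨l', r, hr, hw, hlen, h7, hlow, hhigh, rfl⟩ hz hcost
    simp only [RExp.eval] at hz
    have : r = s'.reg 4 := by omega
    subst this
    simp only [RExp.cost, hz] at hcost
    exact ⟨by omega, l', hw, hlen, hlow, hhigh⟩

theorem writeList_spec (hs : Stored P s) (hrk : ∀ a, StoresRanks P s a (P.prefA a).length)
    (h : Writing P s s' a []) :
    Spec writeList s' fun c t =>
      c ≤ (Fintype.card A + Fintype.card B + 4) * (40 * (P.prefA a).length + 30) + 50 ∧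
      ∃ l, Writing P s t a l ∧ CompleteList I a l ∧
        l.length ≤ (P.prefA a).length * (Fintype.card A + Fintype.card B + 3) := by
  refine spec_seq ((lowRounds_spec hs hrk h).mono ?_)
  rintro c₁ s₁ ⟨hc₁, l₁, hw₁, hlen₁, hlow₁⟩
  refine spec_seq ((mergeRound_spec hs hrk hw₁ hlow₁).mono ?_)
  rintro c₂ s₂ ⟨hc₂, l₂, hsub₂, hw₂, hlen₂, hhigh₂⟩
  have hs₂ : Stored P s₂ := hs.agree hw₂.agree (by decide) (by decide) (by decide)
  -- Common end of both branches, where register `4` is `|A| + 1` for a critical `a` and `1`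
  -- otherwise.
  have last : ∀ (c : ℕ) (t : RState), c ≤ 14 → Writing P s t a l₂ →
      t.reg 7 = Fintype.card B + 1 → 1 ≤ t.reg 4 → t.reg 4 ≤ Fintype.card A + 1 →
      (1 < t.reg 4 → a ∈ I.critA) → (a ∈ I.critA → t.reg 4 = Fintype.card A + 1) →
      Spec highRounds t fun d t => c₁ + (c₂ + (c + d)) ≤
        (Fintype.card A + Fintype.card B + 4) * (40 * (P.prefA a).length + 30) + 50 ∧
      ∃ l, Writing P s t a l ∧ CompleteList I a l ∧
        l.length ≤ (P.prefA a).length * (Fintype.card A + Fintype.card B + 3) := by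
    intro c t hc hw h7 hpos hle hcrit hcrit'
    refine (highRounds_spec hs hrk hw (hlow₁.mono le_rfl hsub₂) hhigh₂ h7 hcrit).mono ?_
    rintro d u ⟨hd, l₃, hw₃, hlen₃, hlow₃, hhigh₃⟩
    refine ⟨?_, l₃, hw₃, ⟨hlow₃, hhigh₃.mono hpos (List.Subset.refl _), fun hcr => ?_⟩, ?_⟩
    · have := Nat.mul_le_mul_right (40 * (P.prefA a).length + 30) hle
      have e : (Fintype.card A + Fintype.card B + 4) * (40 * (P.prefA a).length + 30) =
          Fintype.card B * (40 * (P.prefA a).length + 30) +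
          (Fintype.card A + 1) * (40 * (P.prefA a).length + 30) +
          3 * (40 * (P.prefA a).length + 30) := by ring
      omega
    · rw [← hcrit' hcr]
      exact hhigh₃
    · have := Nat.mul_le_mul_right (P.prefA a).length hle
      have e : (P.prefA a).length * (Fintype.card A + Fintype.card B + 3) =
          Fintype.card B * (P.prefA a).length + (Fintype.card A + 1) * (P.prefA a).length +
          2 * (P.prefA a).length := by ring
      omega
  refine spec_seq (spec_set (spec_seq (spec_set (spec_seq (spec_ite (fun hc => ?_) fun hc => ?_)))))
  · simp only [RExp.eval, arr_setReg, reg_setReg, hw₂.vertex, if_false,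
      show (2 : ℕ) ≠ 4 by decide, show (2 : ℕ) ≠ 7 by decide] at hc
    rw [hw₂.agree.arr 3 (by decide), hs.critA] at hc
    refine spec_set ?_
    refine (last 14 _ le_rfl (((hw₂.setReg (by decide) _).setReg (by decide) _).setReg
      (by decide) _) ?_ ?_ ?_ ?_ ?_).mono ?_
    · simp [RExp.eval, hs₂.cardB]
    · simp [RExp.eval]
    · simp [RExp.eval, hs₂.cardA]
    · exact fun _ => hc
    · simp [RExp.eval, hs₂.cardA]
    · rintro d t ⟨hd, ht⟩
      simp only [RExp.cost]
      exact ⟨by omega, ht⟩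
  · simp only [RExp.eval, arr_setReg, reg_setReg, hw₂.vertex, if_false,
      show (2 : ℕ) ≠ 4 by decide, show (2 : ℕ) ≠ 7 by decide] at hc
    have hncr : a ∉ I.critA := by
      rw [← hs.critA, ← hw₂.agree.arr 3 (by decide), not_not]
      exact hc
    refine spec_skip ?_
    refine (last 14 _ le_rfl ((hw₂.setReg (by decide) _).setReg (by decide) _)
      ?_ ?_ ?_ ?_ ?_).mono ?_
    · simp [RExp.eval, hs₂.cardB]
    · simp [RExp.eval]
    · simp [RExp.eval]
    · simp [RExp.eval]
    · exact fun h => absurd h hncr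
    · rintro d t ⟨hd, ht⟩
      simp only [RExp.cost]
      exact ⟨by omega, ht⟩

end Generate

section Run

variable {A B : Type*} [Fintype A] [Fintype B] {I : MarriageInstance A B} {P : Presentation I}
  {s : RState} {l : A → List (Offer B)}

theorem completeList_nil {a : A} (h : ∀ b, (a, b) ∉ I.edges) : CompleteList I a [] :=
  ⟨fun _ _ b _ he => absurd he (h b), ⟨fun b he => absurd he (h b), fun _ _ b he => absurd he (h b)⟩,
    fun _ => ⟨fun b he => absurd he (h b), fun _ _ b he => absurd he (h b)⟩⟩

theorem writeLists_spec (hs : Stored P s) (hrk : ∀ a, StoresRanks P s a (P.prefA a).length)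
    (h13 : s.arr 13 0 = 0) (h5 : s.reg 5 = 0) :
    Spec writeLists s fun c t =>
      c ≤ I.edges.card * (70 * (Fintype.card A + Fintype.card B + 4) + 50) +
        40 * Fintype.card A + 6 ∧
      Agree {10, 11, 12, 13} {2, 3, 4, 5, 6, 7, 8, 9} s t ∧
      ∃ l : A → List (Offer B), ∀ a, StoresList P t a (l a) := by
  refine spec_seq (spec_set (spec_loop (fun n t =>
    Agree {10, 11, 12, 13} {2, 3, 4, 5, 6, 7, 8, 9} s t ∧ t.reg 2 ≤ Fintype.card A ∧
    (∀ c, (P.idxA c : ℕ) < t.reg 2 →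
      t.arr 13 ((P.idxA c : ℕ) + 1) ≤ t.reg 5 ∧ ∃ l, StoresList P t c l) ∧
    t.reg 5 = t.arr 13 (t.reg 2) ∧
    n = (I.edges.card - s.arr 0 (t.reg 2)) * (70 * (Fintype.card A + Fintype.card B + 4) + 50) +
      40 * (Fintype.card A - t.reg 2)) ?_
    ⟨(Agree.refl _ _ _).setReg (by decide) _, by simp [RExp.eval], by simp [RExp.eval],
      by simp [RExp.eval, h13, h5], rfl⟩ ?_))
  · rintro n t ⟨ha, hle, hdone, hpos, rfl⟩ hne
    have ht : Stored P t := hs.agree ha (by decide) (by decide) (by decide)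
    simp only [RExp.eval, ht.cardA] at hne
    obtain ⟨a, h2⟩ := exists_idxA (P := P) (i := t.reg 2) (by omega)
    have h0 : t.arr 0 = s.arr 0 := ha.arr 0 (by decide)
    have hsucc := hs.off_succ a
    have hmono := hs.sideA.mono (show (P.idxA a : ℕ) + 1 ≤ _ from (P.idxA a).2) le_rfl
    rw [hs.arr_card] at hmono
    refine spec_seq (spec_set (spec_seq ?_))
    set t₁ := t.setReg 9 (RExp.eval t (.get 0 (.add (.reg 2) (.lit 1)))) with ht₁
    have hw : Writing P s t₁ a [] := by
      refine ⟨ha.setReg (by decide) _, by simp [ht₁, h2], ?_, ?_, ?_, ?_, ?_⟩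
      · simp [ht₁, RExp.eval, ← h2, h0, hsucc]
      · simp only [ht₁, arr_setReg, reg_setReg, show (5 : ℕ) ≠ 9 by decide, if_false]
        intro c hc
        obtain ⟨h1, l, h2⟩ := hdone c (by omega)
        exact ⟨h1, l, h2.1, h2.2, h2.3, h2.4, h2.5⟩
      · simp [ht₁, hpos, h2]
      · intro k o hk
        simp at hk
      · intro k o hk
        simp at hk
    have fin : ∀ (l : List (Offer B)) (u : RState) (c : ℕ),
        c ≤ (P.prefA a).length * (70 * (Fintype.card A + Fintype.card B + 4) + 50) + 15 →
        Writing P s u a l → CompleteList I a l →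
        l.length ≤ (P.prefA a).length * (Fintype.card A + Fintype.card B + 3) →
        Spec (.seq (.set 2 (.add (.reg 2) (.lit 1))) (.put 13 (.reg 2) (.reg 5))) u
          fun d v => ∃ m, (Agree {10, 11, 12, 13} {2, 3, 4, 5, 6, 7, 8, 9} s v ∧
            v.reg 2 ≤ Fintype.card A ∧
            (∀ c, (P.idxA c : ℕ) < v.reg 2 →
              v.arr 13 ((P.idxA c : ℕ) + 1) ≤ v.reg 5 ∧ ∃ l, StoresList P v c l) ∧
            v.reg 5 = v.arr 13 (v.reg 2) ∧
            m = (I.edges.card - s.arr 0 (v.reg 2)) *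
              (70 * (Fintype.card A + Fintype.card B + 4) + 50) +
              40 * (Fintype.card A - v.reg 2)) ∧
          m + (6 + (c + d)) + (RExp.sub (.reg 0) (.reg 2)).cost + 1 ≤
            (I.edges.card - s.arr 0 (t.reg 2)) *
              (70 * (Fintype.card A + Fintype.card B + 4) + 50) +
              40 * (Fintype.card A - t.reg 2) := by
      intro l u c hc hwu hcl hlen
      refine spec_seq (spec_set (spec_put ⟨_, ⟨(hwu.agree.setReg (by decide) _).setArr
        (by decide) _ _, ?_, ?_, ?_, rfl⟩, ?_⟩))
      · simp [RExp.eval, hwu.vertex]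
      · intro c hc
        simp only [RExp.eval, reg_setArr, reg_setReg, if_true, hwu.vertex] at hc
        rcases Nat.lt_succ_iff_lt_or_eq.1 hc with hc | hc
        · obtain ⟨h1, l', h2⟩ := hwu.before c hc
          have e1 : (P.idxA c : ℕ) ≠ P.idxA a := hc.ne
          have e2 : (P.idxA c : ℕ) ≠ P.idxA a + 1 := by omega
          refine ⟨by simpa [RExp.eval, hwu.vertex, e1] using h1, l', h2.1, h2.2, h2.3, ?_, ?_⟩
          · simpa [RExp.eval, hwu.vertex, e1, e2] using h2.4
          · intro k o hk
            simpa [RExp.eval, hwu.vertex, e1, e2] using h2.5 k o hk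
        · obtain rfl := idxA_inj.1 hc
          refine ⟨by simp [RExp.eval, hwu.vertex], l, hwu.valid, hcl, hlen, ?_, ?_⟩
          · simpa [RExp.eval, hwu.vertex] using hwu.pos
          · intro k o hk
            simpa [RExp.eval, hwu.vertex] using hwu.stored k o hk
      · simp [RExp.eval]
      · simp only [RExp.eval, RExp.cost, reg_setArr, reg_setReg, if_true, hwu.vertex, ← h2]
        have : I.edges.card - s.arr 0 (P.idxA a : ℕ) =
          (I.edges.card - s.arr 0 ((P.idxA a : ℕ) + 1)) + (P.prefA a).length := by omega
        rw [this, add_mul]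
        have := (P.idxA a).2
        omega
    refine spec_ite (fun hc => ?_) fun hc => ?_
    · simp [RExp.eval, ht₁, ← h2, h0, hsucc] at hc
      refine (writeList_spec hs hrk hw).mono ?_
      rintro c u ⟨hcost, l, hwu, hcl, hlen⟩
      refine (fin l u (6 + c) ?_ hwu hcl hlen).mono ?_
      · have hpos : 0 < (P.prefA a).length := List.length_pos_iff.2 hc
        obtain ⟨d, hd⟩ := Nat.exists_eq_add_of_lt hpos
        simp only [zero_add] at hd
        rw [hd] at hcost ⊢
        have e1 : (Fintype.card A + Fintype.card B + 4) * (40 * (d + 1) + 30) =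
          40 * (d * (Fintype.card A + Fintype.card B + 4)) +
            70 * (Fintype.card A + Fintype.card B + 4) := by ring
        have e2 : (d + 1) * (70 * (Fintype.card A + Fintype.card B + 4) + 50) =
          70 * (d * (Fintype.card A + Fintype.card B + 4)) +
            70 * (Fintype.card A + Fintype.card B + 4) + 50 * d + 50 := by ring
        omega
      · rintro d v ⟨m, hm, hle⟩
        refine ⟨m, hm, ?_⟩
        simp only [RExp.cost] at hle ⊢
        omega
    · simp [RExp.eval, ht₁, ← h2, h0, hsucc] at hc
      refine spec_skip ((fin [] t₁ 7 ?_ hw (completeList_nil fun b he => ?_) (by simp)).mono ?_)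
      · omega
      · rw [← P.mem_prefA, hc] at he
        simp at he
      · rintro d v ⟨m, hm, hle⟩
        refine ⟨m, hm, ?_⟩
        simp only [RExp.cost] at hle ⊢
        omega
  · rintro m c t ⟨ha, hle, hdone, hpos, -⟩ hz hcost
    have ht : Stored P t := hs.agree ha (by decide) (by decide) (by decide)
    simp only [RExp.eval, ht.cardA] at hz
    have hall : ∀ a, ∃ l, StoresList P t a l := fun a => (hdone a (by
      have := (P.idxA a).2
      omega)).2
    choose l hl using hall
    refine ⟨?_, ha, l, hl⟩
    simp only [RExp.eval, RExp.cost, reg_setReg, if_true, hs.sideA.1, Nat.sub_zero] at hcost ⊢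
    omega

/-! ## Deferred acceptance on the machine -/

/-- The test whether the offer at register `5` beats the one at register `8`. -/
def beatsTest : RExp :=
  .add (.sub (.get 11 (.reg 5)) (.get 11 (.reg 8)))
    (.sub (.lit 1) (.add (.sub (.get 11 (.reg 8)) (.get 11 (.reg 5)))
      (.sub (.lit 1) (.sub (.get 12 (.reg 8)) (.get 12 (.reg 5))))))

/-- The next offer of the vertex in register `3`; array `14` holds the positions of the current
offers, and array `15` the vertices whose offers are held.  Register `4` is cleared when no vertex
is free any more. -/
def propose : RProg :=
  .seq (.set 5 (.get 14 (.reg 3))) <|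
  .ite (.sub (.get 13 (.add (.reg 3) (.lit 1))) (.reg 5))
    (.seq (.set 6 (.get 10 (.reg 5))) <|
     .seq (.set 7 (.get 15 (.reg 6))) <|
     .ite (.reg 7)
      (.seq (.set 7 (.sub (.reg 7) (.lit 1))) <|
       .seq (.set 8 (.get 14 (.reg 7))) <|
       .ite beatsTest
        (.seq (.put 15 (.reg 6) (.add (.reg 3) (.lit 1))) <|
         .seq (.put 14 (.reg 7) (.add (.reg 8) (.lit 1))) <|
         .set 3 (.reg 7))
        (.put 14 (.reg 3) (.add (.reg 5) (.lit 1))))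
      (.seq (.put 15 (.reg 6) (.add (.reg 3) (.lit 1))) <|
       .set 4 (.lit 0)))
    (.set 4 (.lit 0))

/-- The vertices of `A` enter one at a time, so at most one is free at any moment and no queue is
needed. -/
def proposeAll : RProg :=
  .seq (.set 2 (.lit 0)) <|
  .loop (.sub (.reg 0) (.reg 2)) <|
    .seq (.put 14 (.reg 2) (.get 13 (.reg 2))) <|
    .seq (.set 3 (.reg 2)) <|
    .seq (.set 4 (.lit 1)) <|
    .seq (.loop (.reg 4) propose) <|
    .set 2 (.add (.reg 2) (.lit 1))

-- Positions are only specified on `D`, since array `14` is initialised when a vertex enters.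
-- Holders are shifted by one so that `0` can mean none.
variable (P) in
structure Represents (s t : RState) (D : Set A) (k : A → ℕ) (h : B → Option A) : Prop where
  agree : Agree {14, 15} {2, 3, 4, 5, 6, 7, 8} s t
  pos : ∀ a ∈ D, t.arr 14 (P.idxA a : ℕ) = s.arr 13 (P.idxA a : ℕ) + k a
  hold : ∀ b, t.arr 15 (P.idxB b : ℕ) = (h b).elim 0 fun a => (P.idxA a : ℕ) + 1

namespace Represents

variable {t : RState} {D : Set A} {k : A → ℕ} {h : B → Option A}

theorem setReg (H : Represents P s t D k h) {x : ℕ} (hx : x ∈ ({2, 3, 4, 5, 6, 7, 8} : Finset ℕ))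
    (v : ℕ) : Represents P s (t.setReg x v) D k h :=
  ⟨H.agree.setReg hx v, H.pos, H.hold⟩

open Classical in
theorem setPos (H : Represents P s t D k h) {a : A} :
    Represents P s (t.setArr 14 (P.idxA a) (s.arr 13 (P.idxA a : ℕ) + k a + 1)) D
      (Function.update k a (k a + 1)) h where
  agree := H.agree.setArr (by decide) _ _
  pos c hc := by
    by_cases e : c = a
    · subst e
      simp [add_assoc]
    · have : (P.idxA c : ℕ) ≠ P.idxA a := fun h => e (idxA_inj.1 h)
      simp [this, e, H.pos c hc]
  hold b := by simp [H.hold b]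

open Classical in
theorem setHold (H : Represents P s t D k h) {b : B} {a : A} :
    Represents P s (t.setArr 15 (P.idxB b) (P.idxA a + 1)) D k
      (Function.update h b (some a)) where
  agree := H.agree.setArr (by decide) _ _
  pos c hc := by simp [H.pos c hc]
  hold d := by
    by_cases e : d = b
    · subst e
      simp
    · have : (P.idxB d : ℕ) ≠ P.idxB b := fun h => e (idxB_inj.1 h)
      simp [this, e, H.hold d]

end Represents

theorem propose_spec (hl : ∀ a, StoresList P s a (l a)) {t : RState} {D : Set A} {k : A → ℕ}
    {h : B → Option A} {a : A} (haD : a ∈ D) (H : Represents P s t D k h)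
    (hda : DeferredAcceptance l D (some a) k h) (h3 : t.reg 3 = P.idxA a) (h4 : t.reg 4 = 1) :
    Spec propose t fun c u => c ≤ 60 ∧ u.reg 2 = t.reg 2 ∧ ∃ k' h', Represents P s u D k' h' ∧
      (u.reg 4 = 0 ∧ DeferredAcceptance l D none k' h' ∧
        ∑ a, ((l a).length - k' a) = ∑ a, ((l a).length - k a) ∨
      u.reg 4 = 1 ∧ (∃ a' ∈ D, u.reg 3 = P.idxA a' ∧ DeferredAcceptance l D (some a') k' h') ∧
        (∑ a, ((l a).length - k' a)) + 1 = ∑ a, ((l a).length - k a)) := by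
  have hp := H.pos a haD
  have hnext := (hl a).next
  have h13 : t.arr 13 = s.arr 13 := H.agree.arr 13 (by decide)
  refine spec_seq (spec_set (spec_ite (fun hc => ?_) fun hc => ?_))
  · simp [RExp.eval, h3, h13, hp, hnext] at hc
    obtain ⟨o, ho⟩ : ∃ o, (l a)[k a]? = some o := ⟨_, List.getElem?_eq_getElem (by omega)⟩
    obtain ⟨ho1, ho2, ho3⟩ := (hl a).stored (k a) o ho
    rw [← H.agree.arr 10 (by decide)] at ho1
    rw [← H.agree.arr 11 (by decide)] at ho2
    rw [← H.agree.arr 12 (by decide)] at ho3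
    have hh := H.hold o.dest
    refine spec_seq (spec_set (spec_seq (spec_set (spec_ite (fun hc7 => ?_) fun hc7 => ?_))))
    · simp [RExp.eval, h3, hp, ho1] at hc7
      cases hb : h o.dest with
      | none => simp [hb] at hh; omega
      | some c =>
        simp only [hb, Option.elim_some] at hh
        obtain ⟨hcD, hca, o', ho', hoo⟩ := hda.held _ _ hb
        have hpc := H.pos c hcD
        obtain ⟨-, hq2, hq3⟩ := (hl c).stored (k c) o' ho'
        rw [← H.agree.arr 11 (by decide)] at hq2
        rw [← H.agree.arr 12 (by decide)] at hq3
        refine spec_seq (spec_set (spec_seq (spec_set (spec_ite (fun ht => ?_) fun ht => ?_))))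
        · have hbeats : o.Beats o' := by
            simp [beatsTest, RExp.eval, h3, hp, ho1, hh, hpc, ho2, ho3, hq2, hq3] at ht
            simp only [Offer.Beats]
            omega
          refine spec_seq (spec_put (spec_seq (spec_put (spec_set ?_))))
          refine ⟨by simp [RExp.cost, beatsTest], by simp, _, _, ?_, .inr ⟨?_, ⟨c, hcD, ?_,
            hda.replace haD ho hb ho' hbeats⟩, sum_length_sub_update ho'⟩⟩
          · simp [RExp.eval, h3, hp, ho1, hh, hpc]
            exact ((((((H.setReg (by decide) _).setReg (by decide) _).setReg (by decide) _).setReg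
              (by decide) _).setReg (by decide) _).setHold.setPos).setReg (by decide) _
          · simp [h4]
          · simp [RExp.eval, h3, hp, ho1, hh]
        · have hbeats : ¬ o.Beats o' := by
            simp [beatsTest, RExp.eval, h3, hp, ho1, hh, hpc, ho2, ho3, hq2, hq3] at ht
            simp only [Offer.Beats]
            omega
          refine spec_put ?_
          refine ⟨by simp [RExp.cost, beatsTest], by simp, _, _, ?_, .inr ⟨?_, ⟨a, haD, ?_,
            hda.reject haD ho hb ho' hbeats⟩, sum_length_sub_update ho⟩⟩
          · simp [RExp.eval, h3, hp, ho1, hh, hpc]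
            exact (((((H.setReg (by decide) _).setReg (by decide) _).setReg (by decide) _).setReg
              (by decide) _).setReg (by decide) _).setPos
          · simp [h4]
          · simp [h3]
    · simp [RExp.eval, h3, hp, ho1] at hc7
      cases hb : h o.dest with
      | some c => simp [hb] at hh; omega
      | none =>
        refine spec_seq (spec_put (spec_set ?_))
        refine ⟨by simp [RExp.cost], by simp, _, _, ?_, .inl ⟨?_, hda.accept haD ho hb, rfl⟩⟩
        · simp [RExp.eval, h3, hp, ho1]
          exact ((((H.setReg (by decide) _).setReg (by decide) _).setReg
            (by decide) _).setHold).setReg (by decide) _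
        · simp [RExp.eval]
  · simp [RExp.eval, h3, h13, hp, hnext] at hc
    refine spec_set ⟨by simp [RExp.cost], by simp, k, h,
      (H.setReg (by decide) _).setReg (by decide) _, .inl ⟨by simp [RExp.eval], hda.finish ?_, rfl⟩⟩
    exact List.getElem?_eq_none (by omega)

theorem proposeLoop_spec (hl : ∀ a, StoresList P s a (l a)) {t : RState} {D : Set A} {k : A → ℕ}
    {h : B → Option A} {a : A} (haD : a ∈ D) (H : Represents P s t D k h)
    (hda : DeferredAcceptance l D (some a) k h) (h3 : t.reg 3 = P.idxA a) (h4 : t.reg 4 = 1) :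
    Spec (.loop (.reg 4) propose) t fun c u => u.reg 2 = t.reg 2 ∧ ∃ k' h',
      Represents P s u D k' h' ∧ DeferredAcceptance l D none k' h' ∧
      c + 70 * ∑ a, ((l a).length - k' a) ≤ 70 * ∑ a, ((l a).length - k a) + 72 := by
  -- Each rejection lowers the sum by one; the term with register `4` pays for the last proposal,
  -- which rejects nobody.
  refine spec_loop (fun n u => u.reg 2 = t.reg 2 ∧ ∃ k' h', Represents P s u D k' h' ∧
    (u.reg 4 = 0 ∧ DeferredAcceptance l D none k' h' ∨
     u.reg 4 = 1 ∧ ∃ a' ∈ D, u.reg 3 = P.idxA a' ∧ DeferredAcceptance l D (some a') k' h') ∧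
    n = 70 * (∑ a, ((l a).length - k' a)) + 70 * u.reg 4) ?_
    ⟨rfl, k, h, H, .inr ⟨h4, a, haD, h3, hda⟩, rfl⟩ ?_
  · rintro n u ⟨hu2, k', h', Hu, hcase, rfl⟩ hne
    simp only [RExp.eval] at hne
    rcases hcase with ⟨h0, -⟩ | ⟨hu4, a', ha', hu3, hdu⟩
    · exact absurd h0 hne
    · refine (propose_spec hl ha' Hu hdu hu3 hu4).mono ?_
      rintro c v ⟨hc, hv2, k'', h'', Hv, ⟨hv4, hdv, hsum⟩ | ⟨hv4, hdv, hsum⟩⟩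
      · refine ⟨_, ⟨hv2.trans hu2, k'', h'', Hv, .inl ⟨hv4, hdv⟩, rfl⟩, ?_⟩
        simp only [RExp.cost, hv4, hu4]
        omega
      · refine ⟨_, ⟨hv2.trans hu2, k'', h'', Hv, .inr ⟨hv4, hdv⟩, rfl⟩, ?_⟩
        simp only [RExp.cost, hv4, hu4]
        omega
  · rintro m c u ⟨hu2, k', h', Hu, hcase, rfl⟩ hz hcost
    simp only [RExp.eval] at hz
    rcases hcase with ⟨h0, hdu⟩ | ⟨hu4, -⟩
    · refine ⟨hu2, k', h', Hu, hdu, ?_⟩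
      simp only [RExp.cost, h4] at hcost
      omega
    · omega

theorem proposeAll_spec (hs : Stored P s) (hl : ∀ a, StoresList P s a (l a))
    (h15 : ∀ i, s.arr 15 i = 0) :
    Spec proposeAll s fun c t =>
      c ≤ 70 * (I.edges.card * (Fintype.card A + Fintype.card B + 3)) +
        100 * Fintype.card A + 6 ∧
      ∃ k h, Represents P s t Set.univ k h ∧ DeferredAcceptance l Set.univ none k h := by
  -- The initial potential is the total number of offers, and it bounds all rejections over the
  -- whole run.
  have hW : ∑ a, ((l a).length - 0) ≤ I.edges.card * (Fintype.card A + Fintype.card B + 3) := by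
    rw [← sum_length_prefA (P := P), Finset.sum_mul]
    exact Finset.sum_le_sum fun a _ => (hl a).length_le
  refine spec_seq (spec_set (spec_loop (fun n t => t.reg 2 ≤ Fintype.card A ∧ ∃ k h,
    Represents P s t {a | (P.idxA a : ℕ) < t.reg 2} k h ∧
    DeferredAcceptance l {a | (P.idxA a : ℕ) < t.reg 2} none k h ∧
    n = 70 * (∑ a, ((l a).length - k a)) + 100 * (Fintype.card A - t.reg 2)) ?_
    ⟨by simp [RExp.eval], fun _ => 0, fun _ => none,
      ⟨(Agree.refl _ _ _).setReg (by decide) _, by simp [RExp.eval], by simp [h15]⟩, ?_, rfl⟩ ?_))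
  · rintro n t ⟨hle, k, h, H, hda, rfl⟩ hne
    have ht : Stored P t := hs.agree H.agree (by decide) (by decide) (by decide)
    simp only [RExp.eval, ht.cardA] at hne
    obtain ⟨a, h2⟩ := exists_idxA (P := P) (i := t.reg 2) (by omega)
    have haD : a ∉ {a | (P.idxA a : ℕ) < t.reg 2} := by simp [h2]
    have hk := hda.waiting a haD
    have hset : insert a {a | (P.idxA a : ℕ) < t.reg 2} = {c | (P.idxA c : ℕ) < t.reg 2 + 1} := by
      ext c
      simp only [Set.mem_insert_iff, Set.mem_ofPred_eq, ← h2, Nat.lt_succ_iff_lt_or_eq,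
        idxA_inj (P := P)]
      exact or_comm
    have hda' := hda.activate haD
    rw [hset] at hda'
    have h13 : t.arr 13 = s.arr 13 := H.agree.arr 13 (by decide)
    refine spec_seq (spec_put (spec_seq (spec_set (spec_seq (spec_set (spec_seq ?_))))))
    refine (proposeLoop_spec hl (a := a) (D := {c | (P.idxA c : ℕ) < t.reg 2 + 1}) (k := k)
      (h := h) (by simp [h2]) ?_ hda' (by simp [RExp.eval, h2]) (by simp [RExp.eval])).mono ?_
    · refine ⟨((H.agree.setArr (by decide) _ _).setReg (by decide) _).setReg (by decide) _, ?_, ?_⟩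
      · intro c hc
        rw [Set.mem_ofPred_eq] at hc
        rcases Nat.lt_succ_iff_lt_or_eq.1 hc with hc | hc
        · simp [RExp.eval, hc.ne, H.pos c hc]
        · have : c = a := idxA_inj.1 (hc.trans h2.symm)
          subst this
          simp [RExp.eval, h2, hk, h13]
      · intro b
        simpa using H.hold b
    · rintro c u ⟨hu2, k', h', Hu, hdu, hcost⟩
      have hu2' : u.reg 2 = t.reg 2 := by simpa using hu2
      refine spec_set ⟨_, ⟨?_, k', h', ?_, ?_, rfl⟩, ?_⟩
      · simp [RExp.eval, hu2']
        omega
      · simpa [RExp.eval, hu2'] using Hu.setReg (x := 2) (by decide) _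
      · simpa [RExp.eval, hu2'] using hdu
      · simp only [RExp.eval, RExp.cost, reg_setReg, if_true, hu2']
        omega
  · have : {a | (P.idxA a : ℕ) < (s.setReg 2 (RExp.eval s (.lit 0))).reg 2} = ∅ := by
      ext
      simp [RExp.eval]
    rw [this]
    exact .init l
  · rintro m c t ⟨hle, k, h, H, hda, rfl⟩ hz hcost
    have ht : Stored P t := hs.agree H.agree (by decide) (by decide) (by decide)
    simp only [RExp.eval, ht.cardA] at hz
    have : {a | (P.idxA a : ℕ) < t.reg 2} = Set.univ := by
      ext a
      have := (P.idxA a).2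
      simp only [Set.mem_ofPred_eq, Set.mem_univ, iff_true]
      omega
    rw [this] at H hda
    refine ⟨?_, k, h, H, hda⟩
    simp only [RExp.eval, RExp.cost, reg_setReg, if_true] at hcost ⊢
    omega

/-! ## Output -/

/-- A position at the end of the list means that all offers were rejected; the entry in array `8`
then keeps its initial `0`. -/
def writeMatching : RProg :=
  .seq (.set 2 (.lit 0)) <|
  .loop (.sub (.reg 0) (.reg 2)) <|
    .seq (.ite (.sub (.get 13 (.add (.reg 2) (.lit 1))) (.get 14 (.reg 2)))
      (.put 8 (.reg 2) (.add (.get 10 (.get 14 (.reg 2))) (.lit 1))) .skip) <|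
    .set 2 (.add (.reg 2) (.lit 1))

theorem writeMatching_spec (hs : Stored P s) (hl : ∀ a, StoresList P s a (l a)) {k : A → ℕ}
    (hk : ∀ a, s.arr 14 (P.idxA a : ℕ) = s.arr 13 (P.idxA a : ℕ) + k a)
    (h8 : ∀ i, s.arr 8 i = 0) :
    Spec writeMatching s fun c t => c ≤ 40 * Fintype.card A + 6 ∧
      IsOutput P t (acceptedPairs fun a => (l a)[k a]?) := by
  refine spec_seq (spec_set (spec_loop (fun n t => Agree {8} {2} s t ∧
    t.reg 2 ≤ Fintype.card A ∧
    (∀ i, t.reg 2 ≤ i → t.arr 8 i = 0) ∧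
    (∀ a, (P.idxA a : ℕ) < t.reg 2 →
      t.arr 8 (P.idxA a : ℕ) = ((l a)[k a]?).elim 0 fun o => (P.idxB o.dest : ℕ) + 1) ∧
    n = 40 * (Fintype.card A - t.reg 2)) ?_
    ⟨(Agree.refl _ _ _).setReg (by decide) _, by simp [RExp.eval], by simp [h8],
      by simp [RExp.eval], rfl⟩ ?_))
  · rintro n t ⟨ha, hle, hzero, hout, rfl⟩ hne
    have ht : Stored P t := hs.agree ha (by decide) (by decide) (by decide)
    simp only [RExp.eval, ht.cardA] at hne
    obtain ⟨a, h2⟩ := exists_idxA (P := P) (i := t.reg 2) (by omega)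
    have h13 : t.arr 13 = s.arr 13 := ha.arr 13 (by decide)
    have h14 : t.arr 14 = s.arr 14 := ha.arr 14 (by decide)
    have h10 : t.arr 10 = s.arr 10 := ha.arr 10 (by decide)
    have hnext := (hl a).next
    refine spec_seq (spec_ite (fun hc => ?_) fun hc => ?_)
    · simp [RExp.eval, ← h2, h13, h14, hk, hnext] at hc
      obtain ⟨o, ho⟩ : ∃ o, (l a)[k a]? = some o := ⟨_, List.getElem?_eq_getElem (by omega)⟩
      refine spec_put (spec_set ⟨_, ⟨(ha.setArr (by decide) _ _).setReg (by decide) _, ?_, ?_, ?_,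
        rfl⟩, ?_⟩)
      · simp [RExp.eval]; omega
      · intro i hi
        simp only [RExp.eval, reg_setReg, if_true, reg_setArr] at hi
        have : i ≠ t.reg 2 := by omega
        simp [RExp.eval, this, hzero i (by omega)]
      · intro c hc
        simp only [RExp.eval, reg_setReg, if_true, reg_setArr] at hc
        rcases Nat.lt_succ_iff_lt_or_eq.1 hc with hc | hc
        · simp [RExp.eval, hc.ne, hout c hc]
        · have : c = a := idxA_inj.1 (hc.trans h2.symm)
          subst this
          simp [RExp.eval, ← h2, h14, h10, hk, ho, ((hl c).stored _ o ho).1]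
      · simp only [RExp.eval, RExp.cost, reg_setReg, if_true, reg_setArr]
        omega
    · simp [RExp.eval, ← h2, h13, h14, hk, hnext] at hc
      have ho : (l a)[k a]? = none := List.getElem?_eq_none (by omega)
      refine spec_skip (spec_set ⟨_, ⟨ha.setReg (by decide) _, ?_, ?_, ?_, rfl⟩, ?_⟩)
      · simp [RExp.eval]; omega
      · intro i hi
        simp only [RExp.eval, reg_setReg, if_true] at hi
        simp [hzero i (by omega)]
      · intro c hc
        simp only [RExp.eval, reg_setReg, if_true] at hc
        rcases Nat.lt_succ_iff_lt_or_eq.1 hc with hc | hc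
        · simp [hout c hc]
        · have : c = a := idxA_inj.1 (hc.trans h2.symm)
          subst this
          simp [ho, hzero _ (show t.reg 2 ≤ P.idxA c by omega)]
      · simp only [RExp.eval, RExp.cost, reg_setReg, if_true]
        omega
  · rintro m c t ⟨ha, hle, hzero, hout, rfl⟩ hz hcost
    have ht : Stored P t := hs.agree ha (by decide) (by decide) (by decide)
    simp only [RExp.eval, ht.cardA] at hz
    have hout' := fun a => hout a (by have := (P.idxA a).2; omega)
    simp only [RExp.eval, RExp.cost, reg_setReg, if_true] at hcost ⊢
    refine ⟨by omega, fun a b hab => ?_, fun a hab => ?_⟩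
    · obtain ⟨o, ho, rfl⟩ := mem_acceptedPairs.1 hab
      simp [hout', ho]
    · have := unmatched_iff.1 hab
      simp [hout', this]

end Run

/-! ### The whole program and its running time -/

section Main

variable {A B : Type*} [Fintype A] [Fintype B] {I : MarriageInstance A B}

/-- Without edges only a constant number of steps is allowed, so even a scan of `A` must be avoided.
-/
def solve : RProg :=
  .ite (.get 0 (.reg 0))
    (.seq computeRanks <| .seq writeLists <| .seq proposeAll writeMatching) .skip

theorem outcome_of_edges_eq_empty (h : I.edges = ∅) :
    Outcome I (fun _ => none) (fun _ => []) where
  valid a o ho := by cases ho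
  complete a _ := completeList_nil (by simp [h])
  rejected a o ho := by simp at ho
  inj a c o o' ho := by cases ho

theorem solve_spec (P : Presentation I) {s : RState} (h : IsInput P s) :
    Spec solve s fun c t =>
      c ≤ 2000 * ((Fintype.card A + Fintype.card B) * I.edges.card + 1) ∧
      ∃ cur made, Outcome I cur made ∧ IsOutput P t (acceptedPairs cur) := by
  have hs := h.stored
  obtain ⟨-, -, hreg, -, -, harr⟩ := h
  have hE := hs.arr_card
  refine spec_ite (fun hc => ?_) fun hc => ?_
  · simp only [RExp.eval, hs.cardA, hE] at hc
    obtain ⟨⟨a₀, b₀⟩, -⟩ := Finset.card_pos.1 (Nat.pos_of_ne_zero hc)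
    have hA : 0 < Fintype.card A := Fintype.card_pos_iff.2 ⟨a₀⟩
    refine spec_seq ((computeRanks_spec hs).mono ?_)
    rintro c₁ s₁ ⟨hc₁, ha₁, hrk⟩
    have hs₁ : Stored P s₁ := hs.agree ha₁ (by decide) (by decide) (by decide)
    refine spec_seq ((writeLists_spec hs₁ hrk ?_ ?_).mono ?_)
    · rw [ha₁.arr 13 (by decide), harr 13 0 (by omega)]
    · rw [ha₁.reg 5 (by decide), hreg 5 (by omega)]
    rintro c₂ s₂ ⟨hc₂, ha₂, l, hl⟩
    have hs₂ : Stored P s₂ := hs₁.agree ha₂ (by decide) (by decide) (by decide)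
    refine spec_seq ((proposeAll_spec hs₂ hl ?_).mono ?_)
    · intro i
      rw [ha₂.arr 15 (by decide), ha₁.arr 15 (by decide), harr 15 i (by omega)]
    rintro c₃ s₃ ⟨hc₃, k, g, H, hda⟩
    have hs₃ : Stored P s₃ := hs₂.agree H.agree (by decide) (by decide) (by decide)
    have e10 : s₃.arr 10 = s₂.arr 10 := H.agree.arr 10 (by decide)
    have e11 : s₃.arr 11 = s₂.arr 11 := H.agree.arr 11 (by decide)
    have e12 : s₃.arr 12 = s₂.arr 12 := H.agree.arr 12 (by decide)
    have e13 : s₃.arr 13 = s₂.arr 13 := H.agree.arr 13 (by decide)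
    refine (writeMatching_spec hs₃ (l := l) (k := k) ?_ ?_ ?_).mono ?_
    · intro a
      obtain ⟨h1, h2, h3, h4, h5⟩ := hl a
      refine ⟨h1, h2, h3, by rw [e13, h4], ?_⟩
      simpa only [StoresOffers, e10, e11, e12, e13] using h5
    · intro a
      rw [e13, H.pos a trivial]
    · intro i
      rw [H.agree.arr 8 (by decide), ha₂.arr 8 (by decide), ha₁.arr 8 (by decide),
        harr 8 i le_rfl]
    rintro c₄ s₄ ⟨hc₄, hout⟩
    refine ⟨?_, _, _, hda.outcome (fun a => (hl a).valid) (fun a => (hl a).complete), hout⟩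
    -- As `|A|` and `|E|` are positive, both are at most `|A| |E|`, which absorbs the lower order
    -- terms.
    have hE1 : 1 ≤ I.edges.card := Nat.pos_of_ne_zero hc
    have hAE : Fintype.card A ≤ Fintype.card A * I.edges.card := Nat.le_mul_of_pos_right _ hE1
    have hEA : I.edges.card ≤ Fintype.card A * I.edges.card := Nat.le_mul_of_pos_left _ hA
    have k₁ : I.edges.card * (15 * Fintype.card A + 40) =
      15 * (Fintype.card A * I.edges.card) + 40 * I.edges.card := by ring
    have k₂ : I.edges.card * (70 * (Fintype.card A + Fintype.card B + 4) + 50) =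
      70 * (Fintype.card A * I.edges.card) + 70 * (Fintype.card B * I.edges.card) +
        330 * I.edges.card := by ring
    have k₃ : I.edges.card * (Fintype.card A + Fintype.card B + 3) =
      Fintype.card A * I.edges.card + Fintype.card B * I.edges.card + 3 * I.edges.card := by ring
    rw [k₁] at hc₁
    rw [k₂] at hc₂
    rw [k₃] at hc₃
    simp only [RExp.cost, add_mul]
    omega
  · simp only [RExp.eval, hs.cardA, hE] at hc
    refine spec_skip ⟨by simp only [RExp.cost]; omega, _, _,
      outcome_of_edges_eq_empty (Finset.card_eq_zero.1 hc), fun a b hab => ?_, fun a _ => ?_⟩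
    · simp [mem_acceptedPairs] at hab
    · exact harr 8 _ le_rfl

/-! ## Every instance has a presentation -/

theorem exists_sorted_list {V : Type*} (S : Finset V) (f : V → ℕ) :
    ∃ l : List V, l.Nodup ∧ (∀ v, v ∈ l ↔ v ∈ S) ∧ l.Pairwise fun v w => f v ≤ f w := by
  refine ⟨S.toList.insertionSort fun v w => f v ≤ f w, ?_, ?_, ?_⟩
  · exact (List.perm_insertionSort _ _).nodup_iff.2 S.nodup_toList
  · intro v
    rw [(List.perm_insertionSort _ _).mem_iff, Finset.mem_toList]
  · have : Std.Total fun v w => f v ≤ f w := ⟨fun v w => le_total (f v) (f w)⟩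
    have : IsTrans V fun v w => f v ≤ f w := ⟨fun _ _ _ h h' => le_trans h h'⟩
    exact List.pairwise_insertionSort _ _

theorem nonempty_presentation (I : MarriageInstance A B) : Nonempty (Presentation I) := by
  classical
  choose f hf1 hf2 hf3 using fun a : A =>
    exists_sorted_list (Finset.univ.filter fun b => (a, b) ∈ I.edges) (I.rankA a)
  choose g hg1 hg2 hg3 using fun b : B =>
    exists_sorted_list (Finset.univ.filter fun a => (a, b) ∈ I.edges) (I.rankB b)
  exact ⟨⟨Fintype.equivFin A, Fintype.equivFin B, f, g, hf1, hg1, by simp [hf2], by simp [hg2],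
    hf3, hg3⟩⟩

/-- The rows of pairs (neighbour, rank) are concatenated; offsets are lengths of the concatenated
initial rows. -/
theorem exists_storesSide {U V : Type*} [Fintype U] [Fintype V]
    (idx : U ≃ Fin (Fintype.card U)) (idx' : V ≃ Fin (Fintype.card V))
    (pref : U → List V) (rank : U → V → ℕ) (crit : Finset U) (r : ℕ) :
    ∃ f : ℕ → ℕ → ℕ, ∀ s : RState, (∀ j < 4, s.arr (r + j) = f j) →
      StoresSide idx idx' pref rank crit s r := by
  classical
  set L : List (List (ℕ × ℕ)) := List.ofFn fun i : Fin (Fintype.card U) =>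
    (pref (idx.symm i)).map fun v => ((idx' v : ℕ), rank (idx.symm i) v) with hL
  have hLu : ∀ u : U, L[(idx u : ℕ)]? = some ((pref u).map fun v => ((idx' v : ℕ), rank u v)) := by
    intro u
    simp [hL]
  have hsucc : ∀ u : U, (L.take ((idx u : ℕ) + 1)).flatten =
      (L.take (idx u : ℕ)).flatten ++ (pref u).map fun v => ((idx' v : ℕ), rank u v) := by
    intro u
    rw [List.take_add_one, hLu u]
    simp
  refine ⟨fun j i => if j = 0 then (L.take i).flatten.length
    else if j = 1 then (L.flatten[i]?.getD (0, 0)).1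
    else if j = 2 then (L.flatten[i]?.getD (0, 0)).2
    else if ∃ u ∈ crit, (idx u : ℕ) = i then 1 else 0, fun s hs => ?_⟩
  have h0 := hs 0 (by omega)
  have h1 := hs 1 (by omega)
  have h2 := hs 2 (by omega)
  have h3 := hs 3 (by omega)
  simp only [add_zero] at h0
  have look : ∀ u k v, (pref u)[k]? = some v →
      L.flatten[(L.take (idx u : ℕ)).flatten.length + k]? = some ((idx' v : ℕ), rank u v) := by
    intro u k v hk
    have hlt := (List.getElem?_eq_some_iff.1 hk).1
    have split : L.flatten = (L.take (idx u : ℕ)).flatten ++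
        (((pref u).map fun v => ((idx' v : ℕ), rank u v)) ++
          (L.drop ((idx u : ℕ) + 1)).flatten) := by
      rw [← List.append_assoc, ← hsucc, ← List.flatten_append, List.take_append_drop]
    rw [split, List.getElem?_append_right (by omega), Nat.add_sub_cancel_left,
      List.getElem?_append_left (by simpa using hlt)]
    simp [hk]
  refine ⟨by simp [h0], fun u => ?_, fun u k v hk => ?_, fun u => ⟨fun hu => ?_, fun hu => ?_⟩⟩
  · rw [h0]
    simp only [if_true, hsucc, List.length_append, List.length_map]
  · rw [h0, h1, h2]
    simp [-List.length_flatten, look u k v hk]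
  · rw [h3]
    have : ∃ w ∈ crit, (idx w : ℕ) = idx u := ⟨u, hu, rfl⟩
    simp [this]
  · rw [h3]
    have : ¬ ∃ w ∈ crit, (idx w : ℕ) = idx u := by
      rintro ⟨w, hw, e⟩
      rw [Fin.val_inj, idx.apply_eq_iff_eq] at e
      exact hu (e ▸ hw)
    simp only [show (3 : ℕ) ≠ 0 by decide, show (3 : ℕ) ≠ 1 by decide,
      show (3 : ℕ) ≠ 2 by decide, if_false, this]

theorem exists_isInput (P : Presentation I) : ∃ s, IsInput P s := by
  obtain ⟨f, hf⟩ := exists_storesSide P.idxA P.idxB P.prefA I.rankA I.critA 0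
  obtain ⟨g, hg⟩ := exists_storesSide P.idxB P.idxA P.prefB I.rankB I.critB 4
  refine ⟨⟨fun x => if x = 0 then Fintype.card A else if x = 1 then Fintype.card B else 0,
    fun r => if r < 4 then f r else if r < 8 then g (r - 4) else 0⟩,
    by simp, by simp, fun x hx => ?_, hf _ fun j hj => ?_, hg _ fun j hj => ?_, fun r i hr => ?_⟩
  · have h0 : x ≠ 0 := by omega
    have h1 : x ≠ 1 := by omega
    simp [h0, h1]
  · simp [hj]
  · have : 4 + j < 8 := by omega
    simp [this]
  · have h0 : ¬ r < 4 := by omega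
    have h1 : ¬ r < 8 := by omega
    simp [h0, h1]

end Main
end CritMatch

open CritMatch in
theorem theorem1 :
    ∃ (prog : RProg) (c : ℕ),
      ∀ (A : Type*) (B : Type*) [Fintype A] [Fintype B] (I : MarriageInstance A B),
        (∃ M : Finset (A × B), IsCriticalRSM I M ∧
          ∀ M', IsCriticalRSM I M' → (2 / 3 : ℚ) * (M'.card : ℚ) ≤ (M.card : ℚ)) ∧
        ∀ (P : Presentation I) (s : RState), IsInput P s →
          ∃ (M : Finset (A × B)) (k : ℕ) (s' : RState),
            Exec prog s k s' ∧
            k ≤ c * ((Fintype.card A + Fintype.card B) * I.edges.card + 1) ∧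
            IsOutput P s' M ∧
            IsCriticalRSM I M ∧
            ∀ M', IsCriticalRSM I M' → (2 / 3 : ℚ) * (M'.card : ℚ) ≤ (M.card : ℚ) := by
  refine ⟨solve, 2000, fun A B _ _ I => ?_⟩
  have run : ∀ (P : Presentation I) (s : RState), IsInput P s →
      ∃ (M : Finset (A × B)) (k : ℕ) (s' : RState),
        Exec solve s k s' ∧
        k ≤ 2000 * ((Fintype.card A + Fintype.card B) * I.edges.card + 1) ∧
        IsOutput P s' M ∧
        IsCriticalRSM I M ∧
        ∀ M', IsCriticalRSM I M' → (2 / 3 : ℚ) * (M'.card : ℚ) ≤ (M.card : ℚ) := by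
    intro P s h
    obtain ⟨k, t, hexec, hk, cur, made, hcur, hout⟩ := solve_spec P h
    exact ⟨_, k, t, hexec, hk, hout, hcur.isCriticalRSM, fun M' hM' => hcur.two_thirds_le hM'⟩
  -- The purely existential half follows by running the program on any encoding of the instance.
  obtain ⟨P⟩ := nonempty_presentation I
  obtain ⟨s, hs⟩ := exists_isInput P
  obtain ⟨M, -, -, -, -, -, hM, hle⟩ := run P s hs
  exact ⟨⟨M, hM, hle⟩, run⟩
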